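/- Let $\mathbf{H}$ be the real quaternions, $\mathbf{S}_3$ the group of $z\in\mathbf{H}$ with $z\bar z=1$, and $\mathbf{S}_3\to \mathrm{SO}_3(\mathbf{R})$ the homomorphism sending $a$ to the rotation $z\mapsto az\bar a$ of the space of pure quaternions, identified with $\mathbf{R}^3$ by the basis $i,j,k$. Let $\Gamma_0$ be a finite subgroup of $\mathrm{SO}_3(\mathbf{R})$ and let $\Gamma$ be its inverse image in $\mathbf{S}_3$. Let $\Gamma_2$ be the subgroup of $\Gamma\times\Gamma$ generated by the pairs $(x,y)$ with $xy=1$, let $\Gamma_{2,\sigma}$ be the semidirect product of $\Gamma_2$ by a group $\{1,\sigma\}$ of order $2$, where $\sigma$ acts by $(x,y)\mapsto(y,x)$, and let $B(\Gamma)^c$ be the quotient of $\Gamma_{2,\sigma}$ by its central subgroup $\{1,(-1,-1)\}$. Let $\varphi: B(\Gamma)^c\to \mathrm{O}(\mathbf{H})\simeq \mathrm{O}_4(\mathbf{R})$ be the homomorphism sending the class of $(a,b)\in\Gamma_2$ to $z\mapsto az\bar b$ and the class of $\sigma$ to $z\mapsto -\bar z$. Then $\varphi$ is injective, and its image, identified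 with $B(\Gamma)^c$, is a finite subgroup of $\mathrm{O}_4(\mathbf{R})$ generated by reflections. Moreover: (a) if $\Gamma_0$ is cyclic of order $m$, then $B(\Gamma)^c$ is of type $I_2(m)$; (b) if $\Gamma_0$ is dihedral of order $2m$, then $B(\Gamma)^c$ is of type $I_2(m)\times I_2(m)$; (c) if $\Gamma_0\simeq \mathrm{Alt}_4$, then $B(\Gamma)^c$ is of type $D_4$; (d) if $\Gamma_0\simeq \mathrm{Sym}_4$, then $B(\Gamma)^c$ is of type $F_4$; (e) if $\Gamma_0\simeq \mathrm{Alt}_5$, then $B(\Gamma)^c$ is of type $H_4$. Here a group $G$ of isometries is said to be of a given Coxeter type if there is a family $S$ of reflections in $G$ such that $(G,S)$ is a Coxeter system with the Coxeter matrix of that type. For $m\ge 1$, $I_2(m)$ is the type of the dihedral reflection group of order $2m$, so that $I_2(1)=A_1$ and $I_2(2)=A_1\times A_1$; for $m=1$ the dihedral group of order $2m$ is the group of order $2$. -/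

import Mathlib

open scoped Quaternion

noncomputable section

namespace SerreCoxeter

/-! ### Doubling constructions for an abstract group -/

section Doubling

variable (Γ : Type*) [Group Γ]

/-- The subgroup `Γ_2` of `Γ × Γ` generated by the pairs `(x, y)` with `x * y = 1`. -/
def antiDiag : Subgroup (Γ × Γ) :=
  Subgroup.closure {p | p.1 * p.2 = 1}

/-- The group `{1, σ}` of order `2`, acting on `Γ × Γ` by exchanging the two factors. -/
def swapAction : Multiplicative (ZMod 2) →* MulAut (Γ × Γ) :=
  AddMonoidHom.toMultiplicativeLeft
    (ZMod.lift 2 ⟨zmultiplesHom (Additive (MulAut (Γ × Γ)))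
        (Additive.ofMul (MulEquiv.prodComm : Γ × Γ ≃* Γ × Γ)), by
      apply Additive.toMul.injective
      ext p <;> rfl⟩)

theorem swapAction_gen (p : Γ × Γ) :
    swapAction Γ (Multiplicative.ofAdd 1) p = (p.2, p.1) := by
  have h : ((1 : ℤ) : ZMod 2) = 1 := by simp
  simp only [swapAction, AddMonoidHom.coe_toMultiplicativeLeft, Function.comp_apply, toAdd_ofAdd]
  rw [← h, ZMod.lift_coe]
  simp
  rfl

/-- The wreath product `Γ²_σ`, i.e. the semidirect product of `Γ × Γ` by `{1, σ}`. -/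
abbrev Wreath : Type _ := (Γ × Γ) ⋊[swapAction Γ] Multiplicative (ZMod 2)

variable {Γ} in
theorem swapAction_mem_antiDiag (t : Multiplicative (ZMod 2)) {p : Γ × Γ}
    (hp : p ∈ antiDiag Γ) : swapAction Γ t p ∈ antiDiag Γ := by
  have ht : t = 1 ∨ t = Multiplicative.ofAdd 1 := by
    revert t; decide
  rcases ht with rfl | rfl
  · simpa using hp
  · induction hp using Subgroup.closure_induction with
    | mem x hx =>
      rw [swapAction_gen]
      exact Subgroup.subset_closure (mul_eq_one_comm.mp hx)
    | one => rw [map_one]; exact one_mem _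
    | mul x y _ _ hx hy => rw [map_mul]; exact mul_mem hx hy
    | inv x _ hx => rw [map_inv]; exact inv_mem hx

/-- The subgroup `Γ_{2,σ}` of `Γ²_σ`: the semidirect product of `Γ_2` by `{1, σ}`. -/
def wreathAnti : Subgroup (Wreath Γ) where
  carrier := {g | g.left ∈ antiDiag Γ}
  one_mem' := one_mem (antiDiag Γ)
  mul_mem' {a _} ha hb := mul_mem (S := Subgroup (Γ × Γ)) ha (swapAction_mem_antiDiag a.right hb)
  inv_mem' {a} ha :=
    swapAction_mem_antiDiag a.right⁻¹ (inv_mem (S := Subgroup (Γ × Γ)) ha)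

variable {Γ}

/-- For a central element `e`, the subgroup `C_2` of `Γ²_σ` generated by `(e, e)`; it is
`{1, (e, e)}` when `e` has order `2`. -/
def diagCenter (e : Subgroup.center Γ) : Subgroup (Wreath Γ) :=
  Subgroup.zpowers (SemidirectProduct.inl ((e : Γ), (e : Γ)))

instance diagCenter_normal (e : Subgroup.center Γ) : (diagCenter e).Normal := by
  have hc : ∀ g : Wreath Γ, g * SemidirectProduct.inl ((e : Γ), (e : Γ))
      = SemidirectProduct.inl ((e : Γ), (e : Γ)) * g := by
    intro g
    have h := Subgroup.mem_center_iff.mp e.2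
    have ht : g.right = 1 ∨ g.right = Multiplicative.ofAdd 1 := by
      generalize g.right = t
      revert t; decide
    apply SemidirectProduct.ext
    · rcases ht with ht | ht
      · simp [ht, Prod.ext_iff, h]
      · simp [ht, swapAction_gen, Prod.ext_iff, h]
    · simp
  refine ⟨fun n hn g => ?_⟩
  obtain ⟨k, rfl⟩ := Subgroup.mem_zpowers_iff.mp hn
  have h2 : Commute g (SemidirectProduct.inl ((e : Γ), (e : Γ)) ^ k) :=
    Commute.zpow_right (hc g) k
  rw [h2.eq, mul_inv_cancel_right]
  exact hn

/-- The group `B(Γ)^c`: the quotient of `Γ_{2,σ}` by `C_2`. -/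
abbrev BGroup (e : Subgroup.center Γ) : Type _ :=
  wreathAnti Γ ⧸ (diagCenter e).subgroupOf (wreathAnti Γ)

end Doubling

/-! ### Unit quaternions and rotations -/

/-- The group `S_3` of quaternions `z` such that `z * conj z = 1`. -/
abbrev S3 : Type := unitary ℍ[ℝ]

/-- The orthonormal basis `i, j, k` of the pure quaternions. -/
def imBasis : Fin 3 → ℍ[ℝ] := ![⟨0, 1, 0, 0⟩, ⟨0, 0, 1, 0⟩, ⟨0, 0, 0, 1⟩]

/-- The coordinates of the imaginary part of a quaternion in the basis `i, j, k`. -/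
def imCoord (z : ℍ[ℝ]) : Fin 3 → ℝ := ![z.imI, z.imJ, z.imK]

/-- The matrix, in the basis `i, j, k`, of the action `z ↦ a z (conj a)` on pure quaternions. -/
def rotMatrix (a : ℍ[ℝ]) : Matrix (Fin 3) (Fin 3) ℝ :=
  Matrix.of fun r c => imCoord (a * imBasis c * star a) r

theorem rotMatrix_eq (a : ℍ[ℝ]) : rotMatrix a =
    !![a.re ^ 2 + a.imI ^ 2 - a.imJ ^ 2 - a.imK ^ 2,
        2 * (a.imI * a.imJ - a.re * a.imK), 2 * (a.imI * a.imK + a.re * a.imJ);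
      2 * (a.imI * a.imJ + a.re * a.imK),
        a.re ^ 2 - a.imI ^ 2 + a.imJ ^ 2 - a.imK ^ 2, 2 * (a.imJ * a.imK - a.re * a.imI);
      2 * (a.imI * a.imK - a.re * a.imJ), 2 * (a.imJ * a.imK + a.re * a.imI),
        a.re ^ 2 - a.imI ^ 2 - a.imJ ^ 2 + a.imK ^ 2] := by
  ext r c
  fin_cases r <;> fin_cases c <;>
    simp [rotMatrix, imCoord, imBasis, Quaternion.re_mul, Quaternion.imI_mul, Quaternion.imJ_mul,
      Quaternion.imK_mul] <;> ring

theorem rotMatrix_mul (a b : ℍ[ℝ]) : rotMatrix (a * b) = rotMatrix a * rotMatrix b := by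
  simp only [rotMatrix_eq, Quaternion.re_mul, Quaternion.imI_mul, Quaternion.imJ_mul,
    Quaternion.imK_mul]
  generalize a.re = a0, a.imI = a1, a.imJ = a2, a.imK = a3
  generalize b.re = b0, b.imI = b1, b.imJ = b2, b.imK = b3
  ext r c
  fin_cases r <;> fin_cases c <;>
    simp [Matrix.mul_apply, Fin.sum_univ_three] <;> ring

theorem rotMatrix_one : rotMatrix 1 = 1 := by
  ext r c
  fin_cases r <;> fin_cases c <;> simp [rotMatrix, imCoord, imBasis]

theorem normSq_S3 (a : S3) :
    (a : ℍ[ℝ]).re ^ 2 + (a : ℍ[ℝ]).imI ^ 2 + (a : ℍ[ℝ]).imJ ^ 2 + (a : ℍ[ℝ]).imK ^ 2 = 1 := by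
  have h : (a : ℍ[ℝ]) * star (a : ℍ[ℝ]) = 1 := Unitary.coe_mul_star_self a
  rw [Quaternion.self_mul_star, ← Quaternion.coe_one, Quaternion.coe_inj,
    Quaternion.normSq_def'] at h
  exact h

theorem rotMatrix_mem (a : S3) :
    rotMatrix (a : ℍ[ℝ]) ∈ Matrix.specialOrthogonalGroup (Fin 3) ℝ := by
  have h := normSq_S3 a
  rw [rotMatrix_eq]
  revert h
  generalize (a : ℍ[ℝ]).re = w, (a : ℍ[ℝ]).imI = x, (a : ℍ[ℝ]).imJ = y, (a : ℍ[ℝ]).imK = z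
  intro h
  rw [Matrix.mem_specialOrthogonalGroup_iff, Matrix.mem_orthogonalGroup_iff]
  constructor
  · ext r c
    fin_cases r <;> fin_cases c <;>
      simp [Matrix.mul_apply, Fin.sum_univ_three] <;>
      first
      | (linear_combination (w ^ 2 + x ^ 2 + y ^ 2 + z ^ 2 + 1) * h)
      | ring
  · rw [Matrix.det_fin_three]
    simp
    linear_combination ((w ^ 2 + x ^ 2 + y ^ 2 + z ^ 2) ^ 2
      + (w ^ 2 + x ^ 2 + y ^ 2 + z ^ 2) + 1) * h

/-- The double covering `S_3 → SO_3(ℝ)`: a unit quaternion `a` acts on the pure quaternions,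
identified with `ℝ³` by the basis `i, j, k`, by `z ↦ a z (conj a)`. -/
def toSO3 : S3 →* Matrix.specialOrthogonalGroup (Fin 3) ℝ where
  toFun a := ⟨rotMatrix (a : ℍ[ℝ]), rotMatrix_mem a⟩
  map_one' := Subtype.ext rotMatrix_one
  map_mul' a b := Subtype.ext (rotMatrix_mul a b)

/-- The inverse image `Γ` in `S_3` of a subgroup `Γ₀` of `SO_3(ℝ)`. -/
def double (Γ₀ : Subgroup (Matrix.specialOrthogonalGroup (Fin 3) ℝ)) : Subgroup S3 :=
  Γ₀.comap toSO3

theorem toSO3_neg_one : toSO3 (-1) = 1 := by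
  apply Subtype.ext
  change rotMatrix (-1 : ℍ[ℝ]) = 1
  ext r c
  fin_cases r <;> fin_cases c <;> simp [rotMatrix, imCoord, imBasis]

/-- The central element `e = -1` of the inverse image `Γ` of `Γ₀`. -/
def negOne (Γ₀ : Subgroup (Matrix.specialOrthogonalGroup (Fin 3) ℝ)) :
    Subgroup.center (double Γ₀) :=
  ⟨⟨-1, by rw [double, Subgroup.mem_comap, toSO3_neg_one]; exact one_mem _⟩, by
    rw [Subgroup.mem_center_iff]
    intro g
    apply Subtype.ext
    simp⟩

/-! ### The action on `ℝ⁴ = ℍ` -/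

/-- The orthogonal group `O_4(ℝ)`, as the group of linear isometries of `ℍ`, a Euclidean space
of dimension `4`. -/
abbrev O4 : Type := ℍ[ℝ] ≃ₗᵢ[ℝ] ℍ[ℝ]

theorem norm_S3 (a : S3) : ‖(a : ℍ[ℝ])‖ = 1 := CStarRing.norm_coe_unitary a

/-- The isometry `z ↦ a z (conj b)`. -/
def biMul (a b : S3) : O4 where
  toFun z := a * z * star (b : ℍ[ℝ])
  invFun z := star (a : ℍ[ℝ]) * z * b
  map_add' x y := by rw [mul_add, add_mul]
  map_smul' r x := by simp
  left_inv z := by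
    have h1 : star (a : ℍ[ℝ]) * a = 1 := Unitary.coe_star_mul_self a
    have h2 : star (b : ℍ[ℝ]) * b = 1 := Unitary.coe_star_mul_self b
    calc star (a : ℍ[ℝ]) * (a * z * star (b : ℍ[ℝ])) * b
        = (star (a : ℍ[ℝ]) * a) * z * (star (b : ℍ[ℝ]) * b) := by simp only [mul_assoc]
      _ = z := by rw [h1, h2, one_mul, mul_one]
  right_inv z := by
    have h1 : (a : ℍ[ℝ]) * star (a : ℍ[ℝ]) = 1 := Unitary.coe_mul_star_self a
    have h2 : (b : ℍ[ℝ]) * star (b : ℍ[ℝ]) = 1 := Unitary.coe_mul_star_self b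
    calc (a : ℍ[ℝ]) * (star (a : ℍ[ℝ]) * z * b) * star (b : ℍ[ℝ])
        = (a * star (a : ℍ[ℝ])) * z * (b * star (b : ℍ[ℝ])) := by simp only [mul_assoc]
      _ = z := by rw [h1, h2, one_mul, mul_one]
  norm_map' z := by
    change ‖(a : ℍ[ℝ]) * z * star (b : ℍ[ℝ])‖ = ‖z‖
    rw [norm_mul, norm_mul, Quaternion.norm_star, norm_S3, norm_S3, one_mul, mul_one]

theorem biMul_apply (a b : S3) (z : ℍ[ℝ]) : biMul a b z = a * z * star (b : ℍ[ℝ]) := rfl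

/-- The reflection `z ↦ -(conj z)`. -/
def negConj : O4 where
  toFun z := -star z
  invFun z := -star z
  map_add' x y := by rw [star_add, neg_add]
  map_smul' r x := by simp
  left_inv z := by simp
  right_inv z := by simp
  norm_map' z := by
    change ‖-star z‖ = ‖z‖
    rw [norm_neg, Quaternion.norm_star]

theorem negConj_apply (z : ℍ[ℝ]) : negConj z = -star z := rfl

/-- The homomorphism `Γ × Γ → O_4(ℝ)` sending `(a, b)` to `z ↦ a z (conj b)`. -/
def pairToO4 (Γ : Subgroup S3) : Γ × Γ →* O4 where
  toFun p := biMul p.1 p.2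
  map_one' := by
    ext1 z
    simp [biMul_apply]
  map_mul' p q := by
    ext1 z
    simp [biMul_apply, mul_assoc]

/-- The homomorphism `{1, σ} → O_4(ℝ)` sending `σ` to the reflection `z ↦ -(conj z)`. -/
def sigmaToO4 : Multiplicative (ZMod 2) →* O4 :=
  AddMonoidHom.toMultiplicativeLeft
    (ZMod.lift 2 ⟨zmultiplesHom (Additive O4) (Additive.ofMul negConj), by
      apply Additive.toMul.injective
      ext1 z
      simp [pow_two, negConj_apply]⟩)

theorem sigmaToO4_gen : sigmaToO4 (Multiplicative.ofAdd 1) = negConj := by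
  have h : ((1 : ℤ) : ZMod 2) = 1 := by simp
  simp only [sigmaToO4, AddMonoidHom.coe_toMultiplicativeLeft, Function.comp_apply, toAdd_ofAdd]
  rw [← h, ZMod.lift_coe]
  simp

/-- The homomorphism `Γ²_σ → O_4(ℝ)` given by `(a, b) ↦ (z ↦ a z (conj b))` and
`σ ↦ (z ↦ -(conj z))`. -/
def wreathToO4 (Γ : Subgroup S3) : Wreath Γ →* O4 :=
  SemidirectProduct.lift (pairToO4 Γ) sigmaToO4 (by
    intro t
    have ht : t = 1 ∨ t = Multiplicative.ofAdd 1 := by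
      revert t; decide
    rcases ht with rfl | rfl
    · ext1 p
      simp
    · ext1 p
      apply LinearIsometryEquiv.ext
      intro z
      have hinv : negConj⁻¹ = negConj := rfl
      simp [sigmaToO4_gen, hinv, swapAction_gen, pairToO4, MulAut.conj_apply, negConj_apply,
        biMul_apply, mul_assoc])

/-- The homomorphism `B(Γ)^c → O_4(ℝ)`, where `Γ` is the inverse image of `Γ₀`, induced by
`(a, b) ↦ (z ↦ a z (conj b))` and `σ ↦ (z ↦ -(conj z))`. -/
def bToO4 (Γ₀ : Subgroup (Matrix.specialOrthogonalGroup (Fin 3) ℝ)) :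
    BGroup (negOne Γ₀) →* O4 :=
  QuotientGroup.lift _ ((wreathToO4 (double Γ₀)).comp (wreathAnti (double Γ₀)).subtype) (by
    rintro ⟨g, hg⟩ hg2
    rw [Subgroup.mem_subgroupOf] at hg2
    obtain ⟨k, hk⟩ := Subgroup.mem_zpowers_iff.mp hg2
    change SemidirectProduct.inl _ ^ k = g at hk
    have h1 : wreathToO4 (double Γ₀) (SemidirectProduct.inl
        ((negOne Γ₀ : double Γ₀), (negOne Γ₀ : double Γ₀))) = 1 := by
      apply LinearIsometryEquiv.ext
      intro z
      have h2 : (((negOne Γ₀ : double Γ₀) : S3) : ℍ[ℝ]) = -1 := rfl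
      simp [wreathToO4, pairToO4, biMul_apply, h2]
    change wreathToO4 (double Γ₀) g = 1
    rw [← hk, map_zpow, h1, one_zpow])

/-! ### Reflection groups and their types -/

section Types

variable {V : Type*} [NormedAddCommGroup V] [InnerProductSpace ℝ V] [FiniteDimensional ℝ V]

/-- An isometry is a reflection if it is the orthogonal reflection in a hyperplane. -/
def IsReflection (g : V ≃ₗᵢ[ℝ] V) : Prop :=
  ∃ v : V, v ≠ 0 ∧ g = (ℝ ∙ v)ᗮ.reflection

/-- `G` is a finite group generated by reflections. -/
def IsFiniteReflectionGroup (G : Subgroup (V ≃ₗᵢ[ℝ] V)) : Prop :=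
  Finite G ∧ Subgroup.closure {g | g ∈ G ∧ IsReflection g} = G

/-- `G` is of the type given by the Coxeter matrix `M`: there is a family `S` of reflections in
`G` such that `(G, S)` is a Coxeter system with Coxeter matrix `M`. -/
def IsOfType {B : Type*} (G : Subgroup (V ≃ₗᵢ[ℝ] V)) (M : CoxeterMatrix B) : Prop :=
  ∃ cs : CoxeterSystem M G, ∀ i, IsReflection (cs.simple i : V ≃ₗᵢ[ℝ] V)

end Types

/-- The rank of `I_2(m)`; note that `I_2(1) = A_1`. -/
def rankI2 : ℕ → ℕ
  | 1 => 1
  | _ => 2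

/-- The Coxeter matrix of type `I_2(m)`, the type of the dihedral reflection group of order `2m`,
with `I_2(1) = A_1` and `I_2(2) = A_1 × A_1`. The value at `m = 0` is the infinite dihedral type. -/
def matI2 : (m : ℕ) → CoxeterMatrix (Fin (rankI2 m))
  | 0 =>
    { M := Matrix.of fun i j => if i = j then 1 else 0
      isSymm := by ext i j; simp [eq_comm]
      diagonal := by simp
      off_diagonal := by simp }
  | 1 => CoxeterMatrix.A 1
  | m + 2 => CoxeterMatrix.I m

/-- The Coxeter matrix of a product of Coxeter groups: generators of different factors commute. -/
def matProd {B B' : Type*} (M : CoxeterMatrix B) (M' : CoxeterMatrix B') :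
    CoxeterMatrix (B ⊕ B') where
  M := Matrix.fromBlocks M.M (Matrix.of fun _ _ => 2) (Matrix.of fun _ _ => 2) M'.M
  isSymm := Matrix.IsSymm.fromBlocks M.isSymm rfl M'.isSymm
  diagonal i := by cases i <;> simp
  off_diagonal i j h := by
    rcases i with i | i <;> rcases j with j | j
    · simpa using M.off_diagonal i j (fun h' => h (by rw [h']))
    · simp
    · simp
    · simpa using M'.off_diagonal i j (fun h' => h (by rw [h']))

/-- The Coxeter matrix of type `D_4`: the vertex `0` is joined to the three others by simple edges.
(Mathlib's `CoxeterMatrix.D 4` contains a triangle and is not of type `D_4`.) -/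
def matD4 : CoxeterMatrix (Fin 4) where
  M := !![1, 3, 3, 3;
          3, 1, 2, 2;
          3, 2, 1, 2;
          3, 2, 2, 1]
  isSymm := by ext i j; fin_cases i <;> fin_cases j <;> rfl
  diagonal i := by fin_cases i <;> rfl
  off_diagonal i j h := by fin_cases i <;> fin_cases j <;> simp at h ⊢

end SerreCoxeter

end

/-! For a unit quaternion `a`, the orthogonal reflection along `a` is `s_a : z ↦ -a z̄ a`. In the
image of `B(Γ)^c`, `(a, a⁻¹)` acts as `s_a s_1` and `σ` acts as `s_1`, so the image is generated by
the `s_a` with `a ∈ Γ`. The reflection `s_a` depends only on `±a`, i.e. on the rotation in `Γ₀`, and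
`s_a s_b s_a = s_{a b⁻¹ a}`, so `Γ` is stable under its own reflections: it plays the role of a root
system.

The type is found by exhibiting simple roots in `Γ` (`isOfType_of_roots`): vectors with Gram matrix
`-cos(π / m_ij)`, in an open half-space, from which all of `Γ₀` is reached by `(x, y) ↦ x y⁻¹ x`.
These relations give a map from the abstract Coxeter group onto the image. It is injective by Tits'
argument (`geometricRepresentation_injective`): a linear form positive on the simple roots is
nonnegative on `w α_i` unless `i` is a right descent of `w`.

The inner product of two roots is the real part of `a b⁻¹`, a cosine governed by the order of the
corresponding rotation. Hence the Gram matrix can be read in `Γ₀` as an abstract group, up to signs,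
which are fixed along the tree of the Coxeter graph. The only ambiguity is at order `5`, and an
outer automorphism of `Alt_5` removes it. -/

noncomputable section

namespace SerreCoxeter

/-! ### Faithfulness of the geometric representation (Tits) -/

section Tits

open CoxeterSystem

variable {B W : Type*} [Group W] {M : CoxeterMatrix B} (cs : CoxeterSystem M W)

/-- If `i` is not a right descent of `w`, one can strip from the right of `w` an alternating word
in `i, j` of length less than `M i j`, in such a way that neither `i` nor `j` is a right descent of
what remains. -/
theorem exists_mul_alternatingWord {w : W} {i j : B} (hM : M i j ≠ 0)
    (hi : ¬ cs.IsRightDescent w i) :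
    ∃ (k : ℕ) (v : W), k + 1 ≤ M i j ∧ w = v * cs.wordProd (alternatingWord i j k) ∧
      cs.length w = cs.length v + k ∧ ¬ cs.IsRightDescent v i ∧ ¬ cs.IsRightDescent v j := by
  classical
  let P : ℕ → Prop := fun k => ∃ v : W, w = v * cs.wordProd (alternatingWord i j k) ∧
    cs.length w = cs.length v + k
  have hP0 : P 0 := ⟨w, by simp [alternatingWord], rfl⟩
  -- Strip as long an alternating word as possible; additivity of lengths bounds `k` by the length
  -- of `w`.
  obtain ⟨v, hwv, hlen⟩ : P (Nat.findGreatest P (cs.length w)) :=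
    Nat.findGreatest_spec (Nat.zero_le _) hP0
  have hmax : ¬ P (Nat.findGreatest P (cs.length w) + 1) := fun h =>
    Nat.findGreatest_is_greatest (Nat.lt_succ_self _)
      (by obtain ⟨v', -, h'⟩ := h; omega) h
  generalize Nat.findGreatest P (cs.length w) = k at hwv hlen hmax
  -- The letter that would be stripped next is no descent of `v`, by maximality.
  have hnext : ¬ cs.IsRightDescent v (if Even k then j else i) := by
    intro hd
    rw [cs.isRightDescent_iff] at hd
    refine hmax ⟨v * cs.simple (if Even k then j else i), ?_, by omega⟩
    rw [alternatingWord_succ', cs.wordProd_cons, ← mul_assoc, cs.simple_mul_simple_cancel_right]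
    exact hwv
  -- The other letter is the last one stripped; were it a descent of `v`, `w` would be too short.
  -- For `k = 0` this is `hi`.
  have hprev : ¬ cs.IsRightDescent v (if Even k then i else j) := by
    rcases k with _ | k
    · have : v = w := by simpa [alternatingWord] using hwv.symm
      simpa [this] using hi
    · intro hd
      have hlt : (if Even (k + 1) then i else j) = if Even k then j else i := by
        by_cases h : Even k <;> simp [h, Nat.even_add_one]
      rw [hlt, cs.isRightDescent_iff] at hd
      have h1 : w = v * cs.simple (if Even k then j else i)
          * cs.wordProd (alternatingWord i j k) := by
        rw [hwv, alternatingWord_succ', cs.wordProd_cons, mul_assoc]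
      have h2 := cs.length_mul_le (v * cs.simple (if Even k then j else i))
        (cs.wordProd (alternatingWord i j k))
      have h3 := cs.length_wordProd_le (alternatingWord i j k)
      rw [← h1] at h2
      rw [length_alternatingWord] at h3
      omega
  refine ⟨k, v, ?_, hwv, hlen, ?_, ?_⟩
  -- Since `i` is no descent, `w s_i` has length `ℓ(v) + k + 1`, so the alternating word of length
  -- `k + 1` is reduced and cannot be longer than `M i j`.
  · by_contra hk
    have h1 : w * cs.simple i = v * cs.wordProd (alternatingWord j i (k + 1)) := by
      rw [alternatingWord_succ, cs.wordProd_concat, ← mul_assoc, ← hwv]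
    have h2 := cs.length_mul_le v (cs.wordProd (alternatingWord j i (k + 1)))
    have h3 := cs.length_wordProd_le (alternatingWord j i (k + 1))
    rw [← h1, (cs.not_isRightDescent_iff).mp hi] at h2
    rw [length_alternatingWord] at h3
    refine cs.not_isReduced_alternatingWord j i (m := k + 1) (by rwa [M.symmetric])
      (by rw [M.symmetric]; omega) ?_
    rw [CoxeterSystem.IsReduced, length_alternatingWord]
    omega
  · by_cases h : Even k
    · simpa [h] using hprev
    · simpa [h] using hnext
  · by_cases h : Even k
    · simpa [h] using hnext
    · simpa [h] using hprev

variable {V : Type*} [NormedAddCommGroup V] [InnerProductSpace ℝ V] {cs} {α : B → V}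
  {f : W →* (V ≃ₗᵢ[ℝ] V)}

/-- The image of a simple root under an alternating product, in terms of the dihedral angle. -/
theorem sin_smul_alternatingWord_apply (hα : ∀ i, inner ℝ (α i) (α i) = 1)
    (hf : ∀ i x, f (cs.simple i) x = x - (2 * inner ℝ (α i) x) • α i) {i j : B} {θ : ℝ}
    (hij : inner ℝ (α i) (α j) = -Real.cos θ) (k : ℕ) :
    Real.sin θ • f (cs.wordProd (alternatingWord i j k)) (α i) =
      Real.sin ((k + 1) * θ) • α (if Even k then i else j)
        + Real.sin (k * θ) • α (if Even k then j else i) := by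
  have hji : inner ℝ (α j) (α i) = -Real.cos θ := by rw [real_inner_comm, hij]
  -- Both simple reflections act on the plane of `α i`, `α j` through the same Chebyshev recurrence.
  have hrec (k : ℕ) : Real.sin (((k + 1 : ℕ) + 1) * θ)
      = 2 * Real.cos θ * Real.sin ((k + 1) * θ) - Real.sin (k * θ) := by
    have h1 : (((k + 1 : ℕ) : ℝ) + 1) * θ = (k + 1) * θ + θ := by push_cast; ring
    have h2 : (k : ℝ) * θ = (k + 1) * θ - θ := by ring
    rw [h1, h2, Real.sin_add, Real.sin_sub]
    ring
  induction k with
  | zero => simp [alternatingWord]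
  | succ k ih =>
    rw [alternatingWord_succ', cs.wordProd_cons, map_mul, LinearIsometryEquiv.coe_mul,
      Function.comp_apply, ← LinearIsometryEquiv.map_smul, ih, map_add,
      LinearIsometryEquiv.map_smul, LinearIsometryEquiv.map_smul, hf, hf, hrec]
    by_cases h : Even k
    · simp only [h, if_true, Nat.even_add_one, not_true, if_false, hα, hji]
      push_cast
      module
    · simp only [h, if_false, Nat.even_add_one, not_false_iff, if_true, hα, hij]
      push_cast
      module

/-- A linear form which is positive on the simple roots is nonnegative on `w α_i` as soon as `i`
is not a right descent of `w`. -/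
theorem inner_apply_root_nonneg (hM : ∀ i j, M i j ≠ 0)
    (hα : ∀ i j, inner ℝ (α i) (α j) = -Real.cos (Real.pi / M i j))
    (hf : ∀ i x, f (cs.simple i) x = x - (2 * inner ℝ (α i) x) • α i)
    {ρ : V} (hρ : ∀ i, 0 < inner ℝ ρ (α i)) (n : ℕ) {w : W} (hn : cs.length w = n) {i : B}
    (hi : ¬ cs.IsRightDescent w i) : 0 ≤ inner ℝ ρ (f w (α i)) := by
  induction n using Nat.strong_induction_on generalizing w i with
  | _ n ih =>
  by_cases hw : w = 1
  · subst hw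
    simpa using (hρ i).le
  obtain ⟨j, hj⟩ := cs.exists_rightDescent_of_ne_one hw
  have hne : i ≠ j := by rintro rfl; exact hi hj
  obtain ⟨k, v, hk, hwv, hlen, hvi, hvj⟩ := exists_mul_alternatingWord cs (hM i j) hi
  -- `j` is a descent of `w` but not of `v`, so `v` is strictly shorter and the induction applies to
  -- `v α_i` and `v α_j`.
  have hk0 : k ≠ 0 := by
    rintro rfl
    have : v = w := by simpa [alternatingWord] using hwv.symm
    exact hvj (this ▸ hj)
  have ihi := ih (cs.length v) (by omega) rfl hvi
  have ihj := ih (cs.length v) (by omega) rfl hvj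
  have hm2 : 2 ≤ M i j := by
    have h0 := hM i j
    have h1 := M.off_diagonal i j hne
    change M i j ≠ 1 at h1
    omega
  have hm : (2 : ℝ) ≤ M i j := by exact_mod_cast hm2
  have hpi := Real.pi_pos
  have hsin : 0 < Real.sin (Real.pi / M i j) := by
    apply Real.sin_pos_of_pos_of_lt_pi (by positivity)
    rw [div_lt_iff₀ (by positivity)]
    nlinarith
  -- As `k + 1 ≤ M i j`, both coefficients expressing `w α_i` through `v α_i` and `v α_j` are
  -- nonnegative.
  have hsin' (l : ℕ) (hl : l ≤ M i j) : 0 ≤ Real.sin (l * (Real.pi / M i j)) := by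
    apply Real.sin_nonneg_of_nonneg_of_le_pi (by positivity)
    rw [← mul_div_assoc, div_le_iff₀ (by positivity), mul_comm]
    gcongr
  have hα1 (i) : inner ℝ (α i) (α i) = 1 := by
    rw [hα, M.diagonal]; simp
  have key := congrArg (fun x => inner ℝ ρ (f v x))
    (sin_smul_alternatingWord_apply (cs := cs) hα1 hf (hα i j) k)
  simp only [map_add, LinearIsometryEquiv.map_smul, inner_add_right, inner_smul_right] at key
  have hfw : f w (α i) = f v (f (cs.wordProd (alternatingWord i j k)) (α i)) := by
    rw [← Function.comp_apply (f := f v), ← LinearIsometryEquiv.coe_mul, ← map_mul, ← hwv]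
  rw [← hfw] at key
  have h1 := hsin' (k + 1) hk
  have h2 := hsin' k (by omega)
  push_cast at h1
  refine nonneg_of_mul_nonneg_right (a := Real.sin (Real.pi / M i j)) ?_ hsin
  rw [key]
  split_ifs
  · exact add_nonneg (mul_nonneg h1 ihi) (mul_nonneg h2 ihj)
  · exact add_nonneg (mul_nonneg h1 ihj) (mul_nonneg h2 ihi)

/-- The geometric representation of a Coxeter group is faithful. -/
theorem geometricRepresentation_injective (hM : ∀ i j, M i j ≠ 0)
    (hα : ∀ i j, inner ℝ (α i) (α j) = -Real.cos (Real.pi / M i j))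
    (hf : ∀ i x, f (cs.simple i) x = x - (2 * inner ℝ (α i) x) • α i)
    {ρ : V} (hρ : ∀ i, 0 < inner ℝ ρ (α i)) : Function.Injective f := by
  rw [injective_iff_map_eq_one]
  intro w hw
  by_contra hne
  obtain ⟨i, hi⟩ := cs.exists_rightDescent_of_ne_one hne
  -- `i` is no descent of `w s_i`; but if `f w = 1`, then `f (w s_i)` sends `α i` to `-α i`.
  have h := inner_apply_root_nonneg hM hα hf hρ _ rfl
    ((cs.isRightDescent_iff_not_isRightDescent_mul).mp hi)
  rw [map_mul, hw, one_mul, hf, hα i i, M.diagonal] at h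
  have h1 := hρ i
  simp only [Nat.cast_one, div_one, Real.cos_pi, inner_sub_right, inner_smul_right] at h
  linarith

end Tits

/-! ### The double covering of the rotation group -/

theorem exists_S3 (w x y z : ℝ) (h : w ^ 2 + x ^ 2 + y ^ 2 + z ^ 2 = 1) :
    ∃ a : S3, (a : ℍ[ℝ]).re = w ∧ (a : ℍ[ℝ]).imI = x ∧ (a : ℍ[ℝ]).imJ = y ∧
      (a : ℍ[ℝ]).imK = z := by
  obtain ⟨q, hq⟩ : ∃ q : ℍ[ℝ], q.re = w ∧ q.imI = x ∧ q.imJ = y ∧ q.imK = z :=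
    ⟨⟨w, x, y, z⟩, rfl, rfl, rfl, rfl⟩
  have hn : q * star q = 1 := by
    rw [Quaternion.self_mul_star, ← Quaternion.coe_one, Quaternion.coe_inj,
      Quaternion.normSq_def', hq.1, hq.2.1, hq.2.2.1, hq.2.2.2, h]
  exact ⟨⟨q, Unitary.mem_iff.mpr ⟨mul_eq_one_comm.mp hn, hn⟩⟩, hq⟩

theorem coe_inv_S3 (a : S3) : ((a⁻¹ : S3) : ℍ[ℝ]) = star (a : ℍ[ℝ]) := rfl

theorem coe_neg_S3 (a : S3) : ((-a : S3) : ℍ[ℝ]) = -(a : ℍ[ℝ]) := rfl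

/-- For the rotation of `w + xi + yj + zk`, `1 + tr R = 4w²`, and the antisymmetric part of `R`
gives `4wx, 4wy, 4wz`. The quaternion is thus known up to a factor, which positivity of `1 + tr R`
allows to normalize. -/
theorem exists_toSO3_eq_of_trace_pos (R : Matrix.specialOrthogonalGroup (Fin 3) ℝ)
    (hR : 0 < 1 + (R : Matrix (Fin 3) (Fin 3) ℝ).trace) : ∃ a : S3, toSO3 a = R := by
  obtain ⟨R, hmem⟩ := R
  rw [Matrix.mem_specialOrthogonalGroup_iff, Matrix.mem_orthogonalGroup_iff] at hmem
  obtain ⟨h1, hdet⟩ := hmem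
  have h2 : R.transpose * R = 1 := mul_eq_one_comm.mp h1
  -- Determinant `1` makes each entry its own cofactor. These quadratic relations and orthonormality
  -- of rows and columns imply linearly all the identities below.
  have h3 : R.adjugate = R.transpose := by
    have h := congrArg (R.transpose * ·) (Matrix.mul_adjugate R)
    simpa [← mul_assoc, h2, hdet] using h
  rw [Matrix.adjugate_fin_three] at h3
  have h1' (i j) := congrFun (congrFun h1 i) j
  have h2' (i j) := congrFun (congrFun h2 i) j
  have h3' (i j) := congrFun (congrFun h3 i) j
  simp only [Matrix.mul_apply, Fin.sum_univ_three, Fin.forall_fin_succ, Matrix.transpose_apply,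
    Fin.isValue, Fin.succ_zero_eq_one, Fin.succ_one_eq_two, IsEmpty.forall_iff, and_true,
    Matrix.one_apply] at h1' h2' h3'
  simp at h1' h2' h3'
  simp only [Matrix.trace_fin_three] at hR
  have hRe := Matrix.eta_fin_three R
  revert hR hRe h1' h2' h3'
  generalize R 0 0 = a, R 0 1 = b, R 0 2 = c, R 1 0 = d, R 1 1 = e, R 1 2 = f, R 2 0 = g,
    R 2 1 = h, R 2 2 = k
  rintro ⟨⟨p1, p2, p3⟩, ⟨p4, p5, p6⟩, p7, p8, p9⟩ ⟨⟨q1, q2, q3⟩, ⟨q4, q5, q6⟩, q7, q8, q9⟩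
    ⟨⟨r1, r2, r3⟩, ⟨r4, r5, r6⟩, r7, r8, r9⟩ hR hRe
  obtain ⟨t, ht⟩ : ∃ t, t = 1 + (a + e + k) := ⟨_, rfl⟩
  rw [← ht] at hR
  obtain ⟨u, hu⟩ : ∃ u : ℝ, u ^ 2 * (4 * t) = 1 := by
    refine ⟨(2 * √t)⁻¹, ?_⟩
    rw [inv_pow, mul_pow, Real.sq_sqrt hR.le]
    field_simp
    norm_num
  have hs : t ^ 2 + (h - f) ^ 2 + (c - g) ^ 2 + (d - b) ^ 2 = 4 * t := by
    subst ht; linarith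
  obtain ⟨q, hq⟩ := exists_S3 (u * t) (u * (h - f)) (u * (c - g)) (u * (d - b))
    (by rw [← hu, ← hs]; ring)
  refine ⟨q, Subtype.ext ?_⟩
  change rotMatrix q = R
  rw [rotMatrix_eq, hRe]
  have key (x y : ℝ) (hxy : x = 4 * t * y) : u ^ 2 * x = y := by
    rw [hxy, ← mul_assoc, hu, one_mul]
  have e1 := key (t ^ 2 + (h - f) ^ 2 - (c - g) ^ 2 - (d - b) ^ 2) a (by subst ht; linarith)
  have e2 := key (2 * ((h - f) * (c - g) - t * (d - b))) b (by subst ht; linarith)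
  have e3 := key (2 * ((h - f) * (d - b) + t * (c - g))) c (by subst ht; linarith)
  have e4 := key (2 * ((h - f) * (c - g) + t * (d - b))) d (by subst ht; linarith)
  have e5 := key (t ^ 2 - (h - f) ^ 2 + (c - g) ^ 2 - (d - b) ^ 2) e (by subst ht; linarith)
  have e6 := key (2 * ((c - g) * (d - b) - t * (h - f))) f (by subst ht; linarith)
  have e7 := key (2 * ((h - f) * (d - b) - t * (c - g))) g (by subst ht; linarith)
  have e8 := key (2 * ((c - g) * (d - b) + t * (h - f))) h (by subst ht; linarith)
  have e9 := key (t ^ 2 - (h - f) ^ 2 - (c - g) ^ 2 + (d - b) ^ 2) k (by subst ht; linarith)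
  ext r s
  fin_cases r <;> fin_cases s <;> simp [hq]
  · refine Eq.trans ?_ e1; ring
  · refine Eq.trans ?_ e2; ring
  · refine Eq.trans ?_ e3; ring
  · refine Eq.trans ?_ e4; ring
  · refine Eq.trans ?_ e5; ring
  · refine Eq.trans ?_ e6; ring
  · refine Eq.trans ?_ e7; ring
  · refine Eq.trans ?_ e8; ring
  · refine Eq.trans ?_ e9; ring

/-- The four numbers `1 + tr(R Q)`, with `Q` the identity or a half-turn about a coordinate axis,
add up to `4`, so one of them is positive. -/
theorem toSO3_surjective : Function.Surjective toSO3 := by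
  intro R
  obtain ⟨i, hi⟩ := exists_S3 0 1 0 0 (by norm_num)
  obtain ⟨j, hj⟩ := exists_S3 0 0 1 0 (by norm_num)
  obtain ⟨k, hk⟩ := exists_S3 0 0 0 1 (by norm_num)
  have hred (q : S3) (h : 0 < 1 + ((R : Matrix (Fin 3) (Fin 3) ℝ) * rotMatrix (q : ℍ[ℝ])).trace) :
      ∃ a, toSO3 a = R := by
    obtain ⟨b, hb⟩ := exists_toSO3_eq_of_trace_pos (R * toSO3 q) h
    exact ⟨b * q⁻¹, by rw [map_mul, hb, map_inv, mul_inv_cancel_right]⟩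
  by_contra hno
  have h0 := mt (hred 1) hno
  have h1 := mt (hred i) hno
  have h2 := mt (hred j) hno
  have h3 := mt (hred k) hno
  rw [rotMatrix_eq] at h0 h1 h2 h3
  simp [Matrix.trace_fin_three, Matrix.mul_apply, Fin.sum_univ_three, hi, hj, hk] at h0 h1 h2 h3
  linarith

theorem eq_one_or_eq_neg_one_of_toSO3_eq_one {a : S3} (h : toSO3 a = 1) : a = 1 ∨ a = -1 := by
  have h' : rotMatrix (a : ℍ[ℝ]) = 1 := congrArg Subtype.val h
  rw [rotMatrix_eq] at h'
  have hn := normSq_S3 a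
  have e1 := congrFun (congrFun h' 0) 0
  have e2 := congrFun (congrFun h' 1) 1
  have e3 := congrFun (congrFun h' 2) 2
  simp at e1 e2 e3
  have hI : (a : ℍ[ℝ]).imI = 0 := by
    apply pow_eq_zero_iff (two_ne_zero) |>.mp; linarith
  have hJ : (a : ℍ[ℝ]).imJ = 0 := by
    apply pow_eq_zero_iff (two_ne_zero) |>.mp; linarith
  have hK : (a : ℍ[ℝ]).imK = 0 := by
    apply pow_eq_zero_iff (two_ne_zero) |>.mp; linarith
  have hre : (a : ℍ[ℝ]).re ^ 2 = 1 := by linarith [e1, e2, e3]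
  rcases mul_self_eq_one_iff.mp ((sq _).symm.trans hre) with h | h
  · left; apply Subtype.ext; ext <;> simp [hI, hJ, hK, h]
  · right; apply Subtype.ext; rw [coe_neg_S3]; ext <;> simp [hI, hJ, hK, h]

theorem toSO3_eq_toSO3_iff {a b : S3} : toSO3 a = toSO3 b ↔ a = b ∨ a = -b := by
  constructor
  · intro h
    have h1 : toSO3 (a * b⁻¹) = 1 := by rw [map_mul, map_inv, h, mul_inv_cancel]
    rcases eq_one_or_eq_neg_one_of_toSO3_eq_one h1 with h | h
    · exact Or.inl (mul_inv_eq_one.mp h)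
    · right; rw [mul_inv_eq_iff_eq_mul] at h; simpa using h
  · rintro (rfl | rfl)
    · rfl
    · rw [← neg_one_mul, map_mul, toSO3_neg_one, one_mul]

instance double_finite (Γ₀ : Subgroup (Matrix.specialOrthogonalGroup (Fin 3) ℝ)) [Finite Γ₀] :
    Finite (double Γ₀) := by
  have hΓ : (Γ₀ : Set (Matrix.specialOrthogonalGroup (Fin 3) ℝ)).Finite := Set.toFinite _
  refine Set.Finite.preimage' (f := toSO3) hΓ fun R _ => ?_
  obtain ⟨a, rfl⟩ := toSO3_surjective R
  exact (Set.toFinite {a, -a}).subset fun b hb => by simpa using toSO3_eq_toSO3_iff.mp hb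

/-! ### The kernel of the action on `ℍ`, and the reflections attached to `Γ` -/

theorem wreathToO4_inl_apply (Γ : Subgroup S3) (p : Γ × Γ) :
    wreathToO4 Γ (SemidirectProduct.inl p) = biMul p.1 p.2 := by
  simp [wreathToO4]; rfl

theorem wreathToO4_inr_gen (Γ : Subgroup S3) :
    wreathToO4 Γ (SemidirectProduct.inr (Multiplicative.ofAdd 1)) = negConj := by
  simp [wreathToO4, sigmaToO4_gen]

/-- The value at `z = 1` forces `a = b`; what remains is the kernel of the double covering. -/
theorem biMul_eq_one {a b : S3} (h : biMul a b = 1) : (a = 1 ∧ b = 1) ∨ (a = -1 ∧ b = -1) := by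
  have h1 : ∀ z : ℍ[ℝ], a * z * star (b : ℍ[ℝ]) = z := fun z => by
    rw [← biMul_apply, h]; rfl
  have hab : a = b := by
    have h2 := h1 1
    rw [mul_one] at h2
    exact mul_inv_eq_one.mp (Subtype.ext h2)
  subst hab
  have : toSO3 a = 1 := by
    apply Subtype.ext
    change rotMatrix (a : ℍ[ℝ]) = 1
    rw [← rotMatrix_one]
    ext r c
    simp only [rotMatrix, Matrix.of_apply, h1]
    simp
  rcases eq_one_or_eq_neg_one_of_toSO3_eq_one this with h | h <;> simp [h]

/-- Otherwise `z = 1` gives `b̄ = -ā`, so `a z̄ = z a` for all `z`. Since conjugation reverses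
products, this would make `i` and `j` commute. -/
theorem biMul_mul_negConj_ne_one (a b : S3) : biMul a b * negConj ≠ 1 := by
  intro h
  have h1 : ∀ z : ℍ[ℝ], a * (-star z) * star (b : ℍ[ℝ]) = z := fun z => by
    rw [← negConj_apply, ← biMul_apply, ← Function.comp_apply (f := biMul a b),
      ← LinearIsometryEquiv.coe_mul, h]; rfl
  have ha : star (a : ℍ[ℝ]) * a = 1 := Unitary.coe_star_mul_self a
  have h2 : star (b : ℍ[ℝ]) = - star (a : ℍ[ℝ]) := by
    have := congrArg (star (a : ℍ[ℝ]) * ·) (h1 1)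
    simp [← mul_assoc, ha] at this
    rw [← this]; simp
  have h3 : ∀ z : ℍ[ℝ], a * star z = z * a := fun z => by
    have := congrArg (· * (a : ℍ[ℝ])) (h1 z)
    simpa [h2, mul_assoc, ha] using this
  obtain ⟨i, hi⟩ := exists_S3 0 1 0 0 (by norm_num)
  obtain ⟨j, hj⟩ := exists_S3 0 0 1 0 (by norm_num)
  have h4 : (a : ℍ[ℝ]) * star (i * j : ℍ[ℝ]) = j * i * a := by
    rw [star_mul, ← mul_assoc, h3, mul_assoc, h3, mul_assoc]
  have h5 : (j * i : ℍ[ℝ]) = i * j := by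
    have h6 := congrArg (· * star (a : ℍ[ℝ])) (h4.symm.trans (h3 _))
    simpa [mul_assoc] using h6
  have h6 := congrArg (·.imK) h5
  simp [hi, hj] at h6
  linarith

theorem bToO4_mk (Γ₀ : Subgroup (Matrix.specialOrthogonalGroup (Fin 3) ℝ))
    (g : wreathAnti (double Γ₀)) :
    bToO4 Γ₀ (QuotientGroup.mk g) = wreathToO4 (double Γ₀) g :=
  rfl

theorem bToO4_injective (Γ₀ : Subgroup (Matrix.specialOrthogonalGroup (Fin 3) ℝ)) :
    Function.Injective (bToO4 Γ₀) := by
  rw [injective_iff_map_eq_one]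
  intro x hx
  obtain ⟨⟨g, hg⟩, rfl⟩ := QuotientGroup.mk_surjective x
  change wreathToO4 (double Γ₀) g = 1 at hx
  rw [QuotientGroup.eq_one_iff, Subgroup.mem_subgroupOf]
  change g ∈ diagCenter (negOne Γ₀)
  have ht : g.right = 1 ∨ g.right = Multiplicative.ofAdd 1 := by
    generalize g.right = t
    revert t; decide
  rw [← SemidirectProduct.inl_left_mul_inr_right g] at hx ⊢
  rcases ht with ht | ht
  · rw [ht, map_one, mul_one] at hx ⊢
    rw [wreathToO4_inl_apply] at hx
    rcases biMul_eq_one hx with ⟨h1, h2⟩ | ⟨h1, h2⟩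
    · have : g.left = 1 := Prod.ext (Subtype.ext h1) (Subtype.ext h2)
      rw [this, map_one]; exact one_mem _
    · have : g.left = ((negOne Γ₀ : double Γ₀), (negOne Γ₀ : double Γ₀)) :=
        Prod.ext (Subtype.ext h1) (Subtype.ext h2)
      rw [this]
      exact Subgroup.mem_zpowers _
  · rw [ht, map_mul, wreathToO4_inl_apply, wreathToO4_inr_gen] at hx
    exact absurd hx (biMul_mul_negConj_ne_one _ _)

/-- The orthogonal reflection `z ↦ -a (conj z) a` in the hyperplane orthogonal to `a`. -/
def reflO4 (a : S3) : O4 := biMul a a⁻¹ * negConj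

theorem reflO4_apply (a : S3) (z : ℍ[ℝ]) : reflO4 a z = -(a * star z * a) := by
  change biMul a a⁻¹ (negConj z) = _
  rw [biMul_apply, negConj_apply]
  change _ * -star z * star (star (a : ℍ[ℝ])) = _
  simp

/-- Multiply `2⟨a, z⟩ = a z̄ + z ā` on the right by `a`. -/
theorem reflO4_apply_eq_sub (a : S3) (z : ℍ[ℝ]) :
    reflO4 a z = z - (2 * inner ℝ (a : ℍ[ℝ]) z) • (a : ℍ[ℝ]) := by
  have h : (2 * inner ℝ (a : ℍ[ℝ]) z) • (1 : ℍ[ℝ]) = a * star z + z * star (a : ℍ[ℝ]) := by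
    rw [Quaternion.inner_def]
    ext <;> simp <;> ring
  have h1 : star (a : ℍ[ℝ]) * a = 1 := Unitary.coe_star_mul_self a
  have h2 := congrArg (· * (a : ℍ[ℝ])) h
  simp only [smul_mul_assoc, one_mul, add_mul, mul_assoc, h1, mul_one] at h2
  rw [reflO4_apply, h2, mul_assoc]
  abel

theorem isReflection_reflO4 (a : S3) : IsReflection (reflO4 a) := by
  have hn := norm_S3 a
  refine ⟨a, fun h => by simp [h] at hn, ?_⟩
  ext1 z
  rw [reflO4_apply_eq_sub, Submodule.reflection_orthogonal_apply,
    Submodule.reflection_singleton_apply, hn]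
  simp [mul_smul, two_smul]

theorem reflO4_neg (a : S3) : reflO4 (-a) = reflO4 a := by
  ext1 z
  simp [reflO4_apply, coe_neg_S3]

theorem reflO4_mul_reflO4 (a b : S3) : reflO4 a * reflO4 b = biMul (a * b⁻¹) (a⁻¹ * b) := by
  apply LinearIsometryEquiv.ext
  intro z
  change reflO4 a (reflO4 b z) = _
  rw [reflO4_apply, reflO4_apply, biMul_apply]
  simp [mul_assoc, coe_inv_S3]

/-- Up to sign, `a b⁻¹ a` is the mirror image of `b` in the hyperplane orthogonal to `a`. This is
the origin of the closure condition `x * y⁻¹ * x ∈ S` used below. -/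
theorem reflO4_conj (a b : S3) : reflO4 a * reflO4 b * reflO4 a = reflO4 (a * b⁻¹ * a) := by
  apply LinearIsometryEquiv.ext
  intro z
  change reflO4 a (reflO4 b (reflO4 a z)) = _
  simp [reflO4_apply, mul_assoc, coe_inv_S3]

theorem biMul_mul_biMul (a b c d : S3) : biMul a b * biMul c d = biMul (a * c) (b * d) := by
  apply LinearIsometryEquiv.ext
  intro z
  change biMul a b (biMul c d z) = _
  simp [biMul_apply, mul_assoc]

theorem biMul_one_one : biMul 1 1 = 1 := by
  apply LinearIsometryEquiv.ext
  intro z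
  simp [biMul_apply]

theorem biMul_pow (a b : S3) (n : ℕ) : biMul a b ^ n = biMul (a ^ n) (b ^ n) := by
  induction n with
  | zero => simp [biMul_one_one]
  | succ n ih => rw [pow_succ, ih, biMul_mul_biMul, pow_succ, pow_succ]

/-- The group `B(Γ)^c` is generated by the reflections attached to the elements of `Γ`. -/
theorem range_bToO4 (Γ₀ : Subgroup (Matrix.specialOrthogonalGroup (Fin 3) ℝ)) :
    (bToO4 Γ₀).range = Subgroup.closure (reflO4 '' (double Γ₀ : Set S3)) := by
  apply le_antisymm
  · rintro _ ⟨x, rfl⟩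
    obtain ⟨⟨g, hg⟩, rfl⟩ := QuotientGroup.mk_surjective x
    change wreathToO4 (double Γ₀) g ∈ _
    have hσ : negConj = reflO4 1 := by
      ext1 z; simp [reflO4_apply, negConj_apply]
    have hσ' : negConj ∈ Subgroup.closure (reflO4 '' (double Γ₀ : Set S3)) := by
      rw [hσ]
      exact Subgroup.subset_closure ⟨1, one_mem _, rfl⟩
    have hl (p) (hp : p ∈ antiDiag (double Γ₀)) : wreathToO4 (double Γ₀)
        (SemidirectProduct.inl p) ∈ Subgroup.closure (reflO4 '' (double Γ₀ : Set S3)) := by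
      induction hp using Subgroup.closure_induction with
      | mem p hp =>
        have h2 : (p.2 : S3) = (p.1 : S3)⁻¹ :=
          congrArg Subtype.val (eq_inv_of_mul_eq_one_right hp)
        have h3 : biMul p.1 p.2 = reflO4 p.1 * negConj := by
          rw [h2, hσ, reflO4_mul_reflO4]; simp
        rw [wreathToO4_inl_apply, h3]
        exact mul_mem (Subgroup.subset_closure ⟨_, p.1.2, rfl⟩) hσ'
      | one => rw [map_one, map_one]; exact one_mem _
      | mul x y _ _ hx hy => rw [map_mul, map_mul]; exact mul_mem hx hy
      | inv x _ hx => rw [map_inv, map_inv]; exact inv_mem hx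
    have ht : g.right = 1 ∨ g.right = Multiplicative.ofAdd 1 := by
      generalize g.right = t
      revert t; decide
    rw [← SemidirectProduct.inl_left_mul_inr_right g, map_mul]
    refine mul_mem (hl _ hg) ?_
    rcases ht with ht | ht
    · rw [ht, map_one, map_one]; exact one_mem _
    · rw [ht, wreathToO4_inr_gen]; exact hσ'
  · rw [Subgroup.closure_le]
    rintro _ ⟨a, ha, rfl⟩
    -- `s_a` is the image of `(a, a⁻¹) σ`.
    have hmem : (SemidirectProduct.inl (⟨a, ha⟩, ⟨a, ha⟩⁻¹) *
        SemidirectProduct.inr (Multiplicative.ofAdd 1) : Wreath (double Γ₀))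
        ∈ wreathAnti (double Γ₀) := by
      change _ ∈ antiDiag (double Γ₀)
      simp only [SemidirectProduct.mul_left, SemidirectProduct.left_inl,
        SemidirectProduct.left_inr, map_one, mul_one]
      exact Subgroup.subset_closure (by simp)
    refine ⟨QuotientGroup.mk ⟨_, hmem⟩, ?_⟩
    rw [bToO4_mk, map_mul, wreathToO4_inl_apply, wreathToO4_inr_gen]
    rfl

theorem isFiniteReflectionGroup_range_bToO4
    (Γ₀ : Subgroup (Matrix.specialOrthogonalGroup (Fin 3) ℝ)) [Finite Γ₀] :
    IsFiniteReflectionGroup (bToO4 Γ₀).range := by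
  constructor
  · have : Finite (Wreath (double Γ₀)) := Finite.of_equiv _ SemidirectProduct.equivProd.symm
    exact Finite.of_surjective _ (bToO4 Γ₀).rangeRestrict_surjective
  · apply le_antisymm
    · rw [Subgroup.closure_le]; exact fun g hg => hg.1
    · conv_lhs => rw [range_bToO4]
      apply Subgroup.closure_mono
      rintro _ ⟨a, ha, rfl⟩
      refine ⟨?_, isReflection_reflO4 a⟩
      rw [range_bToO4]
      exact Subgroup.subset_closure ⟨a, ha, rfl⟩

/-! ### Real parts of the elements of `S_3` and orders of rotations -/

theorem inner_S3 (a b : S3) : inner ℝ (a : ℍ[ℝ]) (b : ℍ[ℝ]) = ((a * b⁻¹ : S3) : ℍ[ℝ]).re := rfl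

theorem inner_self_S3 (a : S3) : inner ℝ (a : ℍ[ℝ]) (a : ℍ[ℝ]) = 1 := by
  rw [real_inner_self_eq_norm_sq, norm_S3, one_pow]

theorem toSO3_eq_one_iff (a : S3) : toSO3 a = 1 ↔ (a : ℍ[ℝ]).re ^ 2 = 1 := by
  constructor
  · intro h
    rcases eq_one_or_eq_neg_one_of_toSO3_eq_one h with rfl | rfl <;> simp [coe_neg_S3]
  · intro h
    have hn := normSq_S3 a
    have hI : (a : ℍ[ℝ]).imI = 0 := by nlinarith
    have hJ : (a : ℍ[ℝ]).imJ = 0 := by nlinarith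
    have hK : (a : ℍ[ℝ]).imK = 0 := by nlinarith
    have : a = 1 ∨ a = -1 := by
      rcases mul_self_eq_one_iff.mp ((sq _).symm.trans h) with h | h
      · left; apply Subtype.ext; ext <;> simp [hI, hJ, hK, h]
      · right; apply Subtype.ext; rw [coe_neg_S3]; ext <;> simp [hI, hJ, hK, h]
    rcases this with rfl | rfl
    · exact map_one _
    · exact toSO3_neg_one

theorem abs_re_eq_of_toSO3_eq {a b : S3} (h : toSO3 a = toSO3 b) :
    |(a : ℍ[ℝ]).re| = |(b : ℍ[ℝ]).re| := by
  rcases toSO3_eq_toSO3_iff.mp h with rfl | rfl <;> simp [coe_neg_S3]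

/-- A unit quaternion satisfies `a² = 2 cos θ · a - 1`, so the real parts of its powers obey the
recurrence of `cos (nθ)`. -/
theorem re_pow_eq_cos {a : S3} {θ : ℝ} (h : (a : ℍ[ℝ]).re = Real.cos θ) (n : ℕ) :
    ((a ^ n : S3) : ℍ[ℝ]).re = Real.cos (n * θ) := by
  have hsq : (a : ℍ[ℝ]) * a = (2 * Real.cos θ) • (a : ℍ[ℝ]) - 1 := by
    have h1 : star (a : ℍ[ℝ]) * a = 1 := Unitary.coe_star_mul_self a
    have h2 : (a : ℍ[ℝ]) = (2 * Real.cos θ) • (1 : ℍ[ℝ]) - star (a : ℍ[ℝ]) := by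
      ext <;> simp [← h]
      ring
    have h3 := congrArg (· * (a : ℍ[ℝ])) h2
    simpa only [sub_mul, h1, smul_mul_assoc, one_mul] using h3
  induction n using Nat.twoStepInduction with
  | zero => simp
  | one => simpa using h
  | more n h0 h1 =>
    have h2 : ((a ^ (n + 2) : S3) : ℍ[ℝ])
        = (2 * Real.cos θ) • ((a ^ (n + 1) : S3) : ℍ[ℝ]) - ((a ^ n : S3) : ℍ[ℝ]) := by
      push_cast
      rw [pow_add, sq, hsq, mul_sub, mul_one, mul_smul_comm, pow_succ]
    have e1 : ((n + 2 : ℕ) : ℝ) * θ = (n + 1 : ℕ) * θ + θ := by push_cast; ring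
    have e2 : (n : ℝ) * θ = (n + 1 : ℕ) * θ - θ := by push_cast; ring
    rw [h2, Quaternion.re_sub, Quaternion.re_smul, h1, h0, e1, e2, Real.cos_add, Real.cos_sub,
      smul_eq_mul]
    ring

/-- If `a` induces a rotation of order `m`, then its real part is `cos (k π / m)`, with `k` prime
to `m`. -/
theorem exists_re_pow_eq_cos (a : S3) {m : ℕ} (hm : 0 < m) (h : orderOf (toSO3 a) = m) :
    ∃ k : ℤ, IsCoprime k m ∧
      ∀ n : ℕ, ((a ^ n : S3) : ℍ[ℝ]).re = Real.cos ((n * k : ℤ) * (Real.pi / m)) := by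
  have hn := normSq_S3 a
  have hre : (a : ℍ[ℝ]).re = Real.cos (Real.arccos (a : ℍ[ℝ]).re) :=
    (Real.cos_arccos (by nlinarith) (by nlinarith)).symm
  generalize Real.arccos (a : ℍ[ℝ]).re = θ at hre
  have hpow (n : ℕ) : toSO3 a ^ n = 1 ↔ Real.sin (n * θ) = 0 := by
    rw [← map_pow, toSO3_eq_one_iff, re_pow_eq_cos hre, Real.cos_sq']
    simp
  have h1 := (hpow m).mp (h ▸ pow_orderOf_eq_one _)
  obtain ⟨k, hk⟩ := Real.sin_eq_zero_iff.mp h1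
  have hm' : (m : ℝ) ≠ 0 := by positivity
  refine ⟨k, ?_, fun n => ?_⟩
  -- If `d` divides `k` and `m`, the power `m / d` of the rotation is already trivial.
  · rw [Int.isCoprime_iff_gcd_eq_one]
    obtain ⟨k', hk'⟩ := Int.gcd_dvd_left k m
    obtain ⟨m', hm'2⟩ := Int.gcd_dvd_right k m
    have hd0 : 0 < Int.gcd k m := Int.gcd_pos_of_ne_zero_right _ (by exact_mod_cast hm.ne')
    generalize Int.gcd k m = d at *
    have hm'0 : 0 < m' := by
      by_contra hneg
      have : (m : ℤ) ≤ 0 := by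
        rw [hm'2]; exact mul_nonpos_of_nonneg_of_nonpos (by positivity) (by omega)
      omega
    lift m' to ℕ using hm'0.le
    have hmd : m = d * m' := by exact_mod_cast hm'2
    have hd : (d : ℝ) ≠ 0 := by positivity
    have h2 : toSO3 a ^ m' = 1 := by
      rw [hpow, Real.sin_eq_zero_iff]
      refine ⟨k', mul_left_cancel₀ hd ?_⟩
      rw [hk', hmd] at hk
      push_cast at hk
      linarith
    have h3 := orderOf_dvd_of_pow_eq_one h2
    rw [h, hmd] at h3
    have h4 := Nat.le_of_dvd (by omega) h3
    have : d ≤ 1 := by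
      by_contra hlt
      have hm0 : 0 < m' := by omega
      nlinarith
    omega
  · rw [re_pow_eq_cos hre]
    congr 1
    field_simp
    push_cast
    linear_combination (-(n : ℝ)) * hk

theorem abs_cos_eq_of_dvd {m : ℕ} (hm : 2 ≤ m) {k : ℤ} (h : (m : ℤ) ∣ k - 1 ∨ (m : ℤ) ∣ k + 1) :
    |Real.cos (k * (Real.pi / m))| = Real.cos (Real.pi / m) := by
  have hm' : (m : ℝ) ≠ 0 := by positivity
  have hm2 : (2 : ℝ) ≤ m := by exact_mod_cast hm
  have hpos : 0 ≤ Real.cos (Real.pi / m) := by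
    apply Real.cos_nonneg_of_neg_pi_div_two_le_of_le
    · linarith [Real.pi_pos, div_nonneg Real.pi_pos.le (Nat.cast_nonneg (α := ℝ) m)]
    · exact div_le_div_of_nonneg_left Real.pi_pos.le (by norm_num) hm2
  rcases h with ⟨q, hq⟩ | ⟨q, hq⟩
  · have : (k : ℝ) * (Real.pi / m) = Real.pi / m + q * Real.pi := by
      have : (k : ℝ) - 1 = m * q := by exact_mod_cast hq
      field_simp
      linarith
    rw [this, Real.cos_add_int_mul_pi, abs_mul, abs_of_nonneg hpos]
    simp
  · have : (k : ℝ) * (Real.pi / m) = -(Real.pi / m) + q * Real.pi := by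
      have : (k : ℝ) + 1 = m * q := by exact_mod_cast hq
      field_simp
      linarith
    rw [this, Real.cos_add_int_mul_pi, abs_mul, Real.cos_neg, abs_of_nonneg hpos]
    simp

/-- Some power of a rotation of order `m`, with exponent prime to `m`, has angle `± 2 π / m`. -/
theorem exists_pow_abs_re_eq (a : S3) {m : ℕ} (hm : 2 ≤ m) (h : orderOf (toSO3 a) = m) :
    ∃ j : ℕ, j.Coprime m ∧ |((a ^ j : S3) : ℍ[ℝ]).re| = Real.cos (Real.pi / m) := by
  obtain ⟨k, ⟨u, v, huv⟩, hre⟩ := exists_re_pow_eq_cos a (by omega) h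
  have hm0 : (m : ℤ) ≠ 0 := by omega
  -- The exponent is the Bézout inverse of `k` modulo `m`, reduced so as to be a natural number.
  obtain ⟨j, hj⟩ := Int.eq_ofNat_of_zero_le (Int.emod_nonneg u hm0)
  have hju : (j : ℤ) * k + (u / m * k + v) * m = 1 := by
    have h1 := Int.emod_add_mul_ediv u m
    rw [hj] at h1
    linear_combination huv + k * h1
  refine ⟨j, ?_, ?_⟩
  · rw [← Nat.isCoprime_iff_coprime]
    exact ⟨k, u / m * k + v, by linarith⟩
  · rw [hre, abs_cos_eq_of_dvd hm]
    exact Or.inl ⟨-(u / m * k + v), by linarith⟩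

/-- The only units modulo `2`, `3` and `4` are `±1`, so the order determines the angle up to sign.
-/
theorem abs_re_eq_of_orderOf_le_four {a : S3} {m : ℕ} (hm : 2 ≤ m) (hm4 : m ≤ 4)
    (h : orderOf (toSO3 a) = m) : |(a : ℍ[ℝ]).re| = Real.cos (Real.pi / m) := by
  obtain ⟨k, hk, hre⟩ := exists_re_pow_eq_cos a (by omega) h
  have h1 := hre 1
  rw [pow_one] at h1
  rw [h1, abs_cos_eq_of_dvd hm]
  rw [Int.isCoprime_iff_gcd_eq_one] at hk
  have h2 : (k % m).gcd m = 1 := by rw [Int.gcd_emod, hk]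
  push_cast
  rw [one_mul]
  have h3 := Int.emod_nonneg k (show (m : ℤ) ≠ 0 by omega)
  have h4 := Int.emod_lt_of_pos k (show (0 : ℤ) < m by omega)
  interval_cases m <;> push_cast at * <;> interval_cases hr : (k % _) <;>
    first | omega | norm_num at h2

/-- Modulo `5` the units are `±1` and `±2`, and doubling turns `±2` into `∓1`. -/
theorem abs_re_eq_or_of_orderOf_eq_five {a : S3} (h : orderOf (toSO3 a) = 5) :
    |(a : ℍ[ℝ]).re| = Real.cos (Real.pi / (5 : ℕ)) ∨
      |((a ^ 2 : S3) : ℍ[ℝ]).re| = Real.cos (Real.pi / (5 : ℕ)) := by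
  obtain ⟨k, hk, hre⟩ := exists_re_pow_eq_cos a (by omega) h
  have h1 := hre 1
  rw [pow_one] at h1
  rw [h1, hre 2]
  have h5 : ¬ (5 : ℤ) ∣ k := fun hd => by
    have := hk.isUnit_of_dvd' hd (dvd_refl _)
    norm_num [Int.isUnit_iff] at this
  by_cases h6 : ((5 : ℕ) : ℤ) ∣ k - 1 ∨ ((5 : ℕ) : ℤ) ∣ k + 1
  · left
    rw [abs_cos_eq_of_dvd (by norm_num)]
    simpa using h6
  · right
    rw [abs_cos_eq_of_dvd (by norm_num)]
    push_cast at *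
    have h7 : k % 5 = 0 ∨ k % 5 = 1 ∨ k % 5 = 2 ∨ k % 5 = 3 ∨ k % 5 = 4 := by omega
    rcases h7 with h7 | h7 | h7 | h7 | h7 <;> omega

/-- Every rotation has a lift to `S_3` making an obtuse or right angle with `b`. -/
theorem exists_lift_inner_nonpos (R : Matrix.specialOrthogonalGroup (Fin 3) ℝ) (b : S3) :
    ∃ a : S3, toSO3 a = R ∧ inner ℝ (b : ℍ[ℝ]) (a : ℍ[ℝ]) ≤ 0 := by
  obtain ⟨a, rfl⟩ := toSO3_surjective R
  rcases le_total (inner ℝ (b : ℍ[ℝ]) (a : ℍ[ℝ])) 0 with h | h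
  · exact ⟨a, rfl, h⟩
  · exact ⟨-a, toSO3_eq_toSO3_iff.mpr (Or.inr rfl), by rw [coe_neg_S3, inner_neg_right]; linarith⟩

/-! ### A criterion for the type -/

/-- The product acts through `(a b⁻¹, a⁻¹ b)`, whose second entry is conjugate to the inverse of the
first. If the `n`-th power of one is `±1`, that of the other is the same sign, and `(-1, -1)` acts
trivially; so the order may be tested on rotations. -/
theorem reflO4_mul_reflO4_pow_eq_one {a b : S3} {n : ℕ}
    (h : (toSO3 a * (toSO3 b)⁻¹) ^ n = 1) : (reflO4 a * reflO4 b) ^ n = 1 := by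
  rw [reflO4_mul_reflO4, biMul_pow]
  have h1 : (a⁻¹ * b) ^ n = b⁻¹ * ((a * b⁻¹) ^ n)⁻¹ * b := by
    have h2 : a⁻¹ * b = b⁻¹ * (a * b⁻¹)⁻¹ * b⁻¹⁻¹ := by group
    rw [h2, conj_pow, inv_pow, inv_inv]
  rw [← map_inv, ← map_mul, ← map_pow] at h
  rcases eq_one_or_eq_neg_one_of_toSO3_eq_one h with h | h
  · rw [h1, h]
    simp [biMul_one_one]
  · have h3 : ((-1 : S3))⁻¹ = -1 := inv_eq_of_mul_eq_one_right (by simp)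
    rw [h1, h, h3]
    apply LinearIsometryEquiv.ext
    intro z
    simp [biMul_apply, coe_neg_S3]

/-- A family of elements of `Γ` with the angles prescribed by a Coxeter matrix, all contained in
an open half-space, and such that every element of `Γ` can be obtained from them by reflections,
is a system of simple roots of `B(Γ)^c`. -/
theorem isOfType_of_roots {Γ₀ : Subgroup (Matrix.specialOrthogonalGroup (Fin 3) ℝ)}
    {B : Type*} {M : CoxeterMatrix B} (hM : ∀ i j, M i j ≠ 0) (a : B → S3)
    (ha : ∀ i, toSO3 (a i) ∈ Γ₀)
    (hord : ∀ i j, (toSO3 (a i) * (toSO3 (a j))⁻¹) ^ M i j = 1)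
    (hinner : ∀ i j, inner ℝ (a i : ℍ[ℝ]) (a j : ℍ[ℝ]) = -Real.cos (Real.pi / M i j))
    {ρ : ℍ[ℝ]} (hρ : ∀ i, 0 < inner ℝ ρ (a i : ℍ[ℝ]))
    (hgen : ∀ S : Set (Matrix.specialOrthogonalGroup (Fin 3) ℝ), (∀ i, toSO3 (a i) ∈ S) →
      (∀ x ∈ S, ∀ y ∈ S, x * y⁻¹ * x ∈ S) → ∀ x ∈ Γ₀, x ∈ S) :
    IsOfType (bToO4 Γ₀).range M := by
  have hmem (i) : reflO4 (a i) ∈ (bToO4 Γ₀).range := by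
    rw [range_bToO4]
    exact Subgroup.subset_closure ⟨a i, ha i, rfl⟩
  have hlift : M.IsLiftable (fun i => (⟨reflO4 (a i), hmem i⟩ : (bToO4 Γ₀).range)) := by
    intro i j
    apply Subtype.ext
    exact reflO4_mul_reflO4_pow_eq_one (hord i j)
  let F : M.Group →* (bToO4 Γ₀).range := M.toCoxeterSystem.lift ⟨_, hlift⟩
  have hF (i) : F (M.toCoxeterSystem.simple i) = ⟨reflO4 (a i), hmem i⟩ :=
    M.toCoxeterSystem.lift_apply_simple hlift i
  have hinj : Function.Injective F := by
    have h1 : Function.Injective ((bToO4 Γ₀).range.subtype.comp F) := by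
      refine geometricRepresentation_injective (cs := M.toCoxeterSystem)
        (α := fun i => (a i : ℍ[ℝ])) hM hinner (fun i x => ?_) hρ
      rw [MonoidHom.comp_apply, hF]
      exact reflO4_apply_eq_sub (a i) x
    exact fun x y h => h1 (congrArg Subtype.val h)
  have hsurj : Function.Surjective F := by
    -- Apply `hgen` to the rotations all of whose lifts have their reflection in the image of `F`;
    -- the choice of lift does not matter, since `s_{-a} = s_a`.
    have hS : ∀ x ∈ Γ₀, ∀ b, toSO3 b = x → reflO4 b ∈ ((bToO4 Γ₀).range.subtype.comp F).range := by
      refine hgen {x | ∀ b, toSO3 b = x →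
        reflO4 b ∈ ((bToO4 Γ₀).range.subtype.comp F).range} ?_ ?_
      · intro i b hb
        have hb' : reflO4 b = reflO4 (a i) := by
          rcases toSO3_eq_toSO3_iff.mp hb with rfl | rfl
          · rfl
          · exact reflO4_neg _
        exact ⟨M.toCoxeterSystem.simple i, by rw [hb', MonoidHom.comp_apply, hF]; rfl⟩
      · intro x hx y hy c hc
        obtain ⟨b, rfl⟩ := toSO3_surjective x
        obtain ⟨d, rfl⟩ := toSO3_surjective y
        have hc' : reflO4 c = reflO4 b * reflO4 d * reflO4 b := by
          rw [reflO4_conj]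
          rw [← map_inv, ← map_mul, ← map_mul] at hc
          rcases toSO3_eq_toSO3_iff.mp hc with rfl | rfl
          · rfl
          · exact reflO4_neg _
        rw [hc']
        exact mul_mem (mul_mem (hx b rfl) (hy d rfl)) (hx b rfl)
    have hle : (bToO4 Γ₀).range ≤ ((bToO4 Γ₀).range.subtype.comp F).range := by
      conv_lhs => rw [range_bToO4]
      rw [Subgroup.closure_le]
      rintro _ ⟨b, hb, rfl⟩
      exact hS _ hb b rfl
    rintro ⟨g, hg⟩
    obtain ⟨w, hw⟩ := hle hg
    exact ⟨w, Subtype.ext hw⟩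
  refine ⟨⟨(MulEquiv.ofBijective F ⟨hinj, hsurj⟩).symm⟩, fun i => ?_⟩
  have : (CoxeterSystem.simple ⟨(MulEquiv.ofBijective F ⟨hinj, hsurj⟩).symm⟩ i :
      (bToO4 Γ₀).range) = ⟨reflO4 (a i), hmem i⟩ := hF i
  rw [this]
  exact isReflection_reflO4 (a i)

/-! ### Rank four -/

/-- The variant of `isOfType_of_roots` in rank four where the Coxeter graph is a tree, in which `p`
gives the parent of each vertex, and where the roots are known only up to sign. -/
theorem isOfType_of_tree {Γ₀ : Subgroup (Matrix.specialOrthogonalGroup (Fin 3) ℝ)}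
    {M : CoxeterMatrix (Fin 4)} (hM : ∀ i j, M i j ≠ 0)
    (h : Fin 4 → Matrix.specialOrthogonalGroup (Fin 3) ℝ) (hmem : ∀ i, h i ∈ Γ₀)
    (hord : ∀ i j, i < j → (h i * (h j)⁻¹) ^ M i j = 1)
    (habs : ∀ i j, i < j → ∀ c : S3, toSO3 c = h i * (h j)⁻¹ →
      |(c : ℍ[ℝ]).re| = Real.cos (Real.pi / M i j))
    (p : Fin 4 → Fin 4) (hp : ∀ i, i ≠ 0 → p i < i)
    (htree : ∀ i j, i < j → i ≠ p j → M i j = 2)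
    (c : Fin 4 → ℝ) (hc : ∀ i, 0 < ∑ j, c j * -Real.cos (Real.pi / M i j))
    (hgen : ∀ S : Set (Matrix.specialOrthogonalGroup (Fin 3) ℝ), (∀ i, h i ∈ S) →
      (∀ x ∈ S, ∀ y ∈ S, x * y⁻¹ * x ∈ S) → ∀ x ∈ Γ₀, x ∈ S) :
    IsOfType (bToO4 Γ₀).range M := by
  obtain ⟨a, ha, hneg⟩ : ∃ a : Fin 4 → S3, (∀ i, toSO3 (a i) = h i) ∧
      ∀ i, i ≠ 0 → inner ℝ (a (p i) : ℍ[ℝ]) (a i : ℍ[ℝ]) ≤ 0 := by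
    obtain ⟨a₀, h₀, -⟩ := exists_lift_inner_nonpos (h 0) 1
    obtain ⟨a₁, h₁, n₁⟩ := exists_lift_inner_nonpos (h 1) a₀
    -- Each sign is chosen against the parent, which is already lifted as `p i < i`; the entries `1`
    -- are fillers that are never read.
    obtain ⟨a₂, h₂, n₂⟩ := exists_lift_inner_nonpos (h 2) (![a₀, a₁, 1, 1] (p 2))
    obtain ⟨a₃, h₃, n₃⟩ := exists_lift_inner_nonpos (h 3) (![a₀, a₁, a₂, 1] (p 3))
    refine ⟨![a₀, a₁, a₂, a₃], fun i => ?_, fun i hi => ?_⟩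
    · fin_cases i <;> simpa
    · have p₁ := hp 1 (by decide)
      have p₂ := hp 2 (by decide)
      have p₃ := hp 3 (by decide)
      fin_cases i
      · exact absurd rfl hi
      · have : p 1 = 0 := by revert p₁; generalize p 1 = x; revert x; decide
        simpa [this] using n₁
      · have : p 2 = 0 ∨ p 2 = 1 := by revert p₂; generalize p 2 = x; revert x; decide
        rcases this with h | h <;> simpa [h] using n₂
      · have : p 3 = 0 ∨ p 3 = 1 ∨ p 3 = 2 := by
          revert p₃; generalize p 3 = x; revert x; decide
        rcases this with h | h | h <;> simpa [h] using n₃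
  have hlt (i j) (hij : i < j) :
      inner ℝ (a i : ℍ[ℝ]) (a j : ℍ[ℝ]) = -Real.cos (Real.pi / M i j) := by
    have h1 := habs i j hij (a i * (a j)⁻¹) (by rw [map_mul, map_inv, ha, ha])
    rw [← inner_S3] at h1
    by_cases hpj : i = p j
    · have hj : j ≠ 0 := by rintro rfl; exact absurd hij (Fin.not_lt_zero i)
      have h2 := hneg j hj
      rw [← hpj] at h2
      rw [← h1, abs_of_nonpos h2, neg_neg]
    -- Vertices not joined in the tree have `M i j = 2`: the roots are orthogonal and signs are
    -- irrelevant.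
    · rw [htree i j hij hpj] at h1 ⊢
      simpa using h1
  have hinner (i j) : inner ℝ (a i : ℍ[ℝ]) (a j : ℍ[ℝ]) = -Real.cos (Real.pi / M i j) := by
    rcases lt_trichotomy i j with hij | rfl | hij
    · exact hlt i j hij
    · rw [inner_self_S3, M.diagonal]; simp
    · rw [real_inner_comm, M.symmetric]; exact hlt j i hij
  -- The products of `∑ c_j a_j` with the roots are the entries of the Gram matrix applied to `c`,
  -- positive by `hc`.
  refine isOfType_of_roots hM a (fun i => by rw [ha]; exact hmem i) (fun i j => ?_) hinner
    (ρ := ∑ j, c j • (a j : ℍ[ℝ])) (fun i => ?_) ?_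
  · rw [ha, ha]
    rcases lt_trichotomy i j with hij | rfl | hij
    · exact hord i j hij
    · simp
    · rw [← inv_inj, ← inv_pow, mul_inv_rev, inv_inv, inv_one, M.symmetric]
      exact hord j i hij
  · rw [sum_inner]
    convert hc i using 2 with j
    rw [real_inner_smul_left, real_inner_comm, hinner]
  · simpa only [ha] using hgen

/-- The list obtained from `L` by adding successively the elements `h i * y⁻¹ * h i`, where `y` is
the element at a given place in the list. -/
def reflectList {G : Type*} [Group G] (h : Fin 4 → G) : List (Fin 4 × ℕ) → List G → List G
  | [], L => L
  | (i, k) :: t, L => reflectList h t (L ++ [h i * (L.getD k (h i))⁻¹ * h i])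

theorem mem_of_mem_reflectList {G : Type*} [Group G] {h : Fin 4 → G} {S : Set G}
    (hS : ∀ i, h i ∈ S) (hmul : ∀ x ∈ S, ∀ y ∈ S, x * y⁻¹ * x ∈ S)
    (t : List (Fin 4 × ℕ)) (L : List G) (hL : ∀ x ∈ L, x ∈ S) :
    ∀ x ∈ reflectList h t L, x ∈ S := by
  induction t generalizing L with
  | nil => exact hL
  | cons q t ih =>
    obtain ⟨i, k⟩ := q
    refine ih _ fun x hx => ?_
    rw [List.mem_append, List.mem_singleton] at hx
    rcases hx with hx | rfl
    · exact hL x hx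
    · refine hmul _ (hS i) _ ?_
      by_cases hk : k < L.length
      · rw [List.getD_eq_getElem _ _ hk]; exact hL _ (List.getElem_mem hk)
      -- Out of range, the default value `h i` makes the new element `h i` itself.
      · rw [List.getD_eq_default _ _ (by omega)]; exact hS i

/-- The values of a permutation, as the digits of a natural number. -/
def permCode {n : ℕ} (g : Equiv.Perm (Fin n)) : ℕ :=
  (List.finRange n).foldl (fun s i => n * s + (g i : ℕ)) 0

/-- The variant of `isOfType_of_tree` where `Γ₀` is isomorphic to a permutation group `K`. The
orders of the rotations determine the angles as long as they are at most four. -/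
theorem isOfType_of_perm {Γ₀ : Subgroup (Matrix.specialOrthogonalGroup (Fin 3) ℝ)}
    {M : CoxeterMatrix (Fin 4)} (N : Fin 4 → Fin 4 → ℕ) (hN : ∀ i j, M i j = N i j)
    (hM : ∀ i j, N i j ≠ 0) {n : ℕ}
    {K : Subgroup (Equiv.Perm (Fin n))} (e : K ≃* Γ₀) (h : Fin 4 → Equiv.Perm (Fin n))
    (hK : ∀ i, h i ∈ K)
    (hord : ∀ i j, i < j → (h i * (h j)⁻¹) ^ N i j = 1 ∧
      ∀ m < N i j, 0 < m → (h i * (h j)⁻¹) ^ m ≠ 1)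
    (hbig : ∀ i j, i < j → 4 < N i j → ∀ c : S3,
      toSO3 c = (e (⟨h i, hK i⟩ * ⟨h j, hK j⟩⁻¹) : Γ₀) →
        |(c : ℍ[ℝ]).re| = Real.cos (Real.pi / N i j))
    (p : Fin 4 → Fin 4) (hp : ∀ i, i ≠ 0 → p i < i)
    (htree : ∀ i j, i < j → i ≠ p j → N i j = 2)
    (c : Fin 4 → ℝ) (hc : ∀ i, 0 < ∑ j, c j * -Real.cos (Real.pi / N i j))
    (t : List (Fin 4 × ℕ)) (hnodup : ((reflectList h t (List.ofFn h)).map permCode).Nodup)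
    (hcard : (reflectList h t (List.ofFn h)).length = Nat.card K) :
    IsOfType (bToO4 Γ₀).range M := by
  simp only [← hN] at hM hord hbig htree hc
  let h' (i : Fin 4) : Matrix.specialOrthogonalGroup (Fin 3) ℝ := (e ⟨h i, hK i⟩ : Γ₀)
  have hh' (i j) : h' i * (h' j)⁻¹ = (e (⟨h i, hK i⟩ * ⟨h j, hK j⟩⁻¹) : Γ₀) := by
    simp [h']
  have hord' (i j) (hij : i < j) : orderOf (h' i * (h' j)⁻¹) = M i j := by
    rw [hh', Subgroup.orderOf_coe, MulEquiv.orderOf_eq, ← Subgroup.orderOf_coe,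
      orderOf_eq_iff (Nat.pos_of_ne_zero (hM i j))]
    exact hord i j hij
  refine isOfType_of_tree hM h' (fun i => (e _).2)
    (fun i j hij => by rw [← hord' i j hij]; exact pow_orderOf_eq_one _)
    (fun i j hij d hd => ?_) p hp htree c hc (fun S hS hmul x hx => ?_)
  · by_cases h4 : 4 < M i j
    · exact hbig i j hij h4 d (by rw [hd, hh'])
    · refine abs_re_eq_of_orderOf_le_four ?_ (by omega) (by rw [hd]; exact hord' i j hij)
      have h0 := hM i j
      have h1 := M.off_diagonal i j hij.ne
      change M i j ≠ 1 at h1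
      omega
  · let T : Set (Equiv.Perm (Fin n)) := {g | ∃ hg : g ∈ K,
      ((e ⟨g, hg⟩ : Γ₀) : Matrix.specialOrthogonalGroup (Fin 3) ℝ) ∈ S}
    have hT : ∀ g ∈ reflectList h t (List.ofFn h), g ∈ T := by
      refine mem_of_mem_reflectList (S := T) (fun i => ⟨hK i, hS i⟩) ?_ t _ ?_
      · rintro x ⟨hx, hxS⟩ y ⟨hy, hyS⟩
        refine ⟨mul_mem (mul_mem hx (inv_mem hy)) hx, ?_⟩
        have h1 : (⟨x * y⁻¹ * x, mul_mem (mul_mem hx (inv_mem hy)) hx⟩ : K)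
            = ⟨x, hx⟩ * ⟨y, hy⟩⁻¹ * ⟨x, hx⟩ := rfl
        rw [h1]
        simpa using hmul _ hxS _ hyS
      · intro x hx
        obtain ⟨i, rfl⟩ := (List.mem_ofFn' _ _).mp hx
        exact ⟨hK i, hS i⟩
    -- The list has as many distinct elements as `K`, so it exhausts `K`. Distinct codes suffice for
    -- this; `permCode` need not be injective.
    have hall : ∀ g ∈ K, g ∈ reflectList h t (List.ofFn h) := by
      classical
      have hsub : (((reflectList h t (List.ofFn h)).toFinset : Finset _) : Set (Equiv.Perm (Fin n)))
          ⊆ (K : Set (Equiv.Perm (Fin n))) := by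
        intro g hg
        exact (hT g (by simpa using hg)).1
      have heq := Set.eq_of_subset_of_ncard_le hsub (by
        rw [Set.ncard_coe_finset, List.toFinset_card_of_nodup hnodup.of_map, hcard]
        exact le_of_eq rfl) (Set.toFinite _)
      intro g hg
      have : g ∈ (K : Set (Equiv.Perm (Fin n))) := hg
      rw [← heq] at this
      simpa using this
    obtain ⟨⟨g, hg⟩, hgx⟩ := e.surjective ⟨x, hx⟩
    obtain ⟨hg', hgS⟩ := hT g (hall g hg)
    rw [hgx] at hgS
    exact hgS

theorem isOfType_D4 {Γ₀ : Subgroup (Matrix.specialOrthogonalGroup (Fin 3) ℝ)}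
    (e : alternatingGroup (Fin 4) ≃* Γ₀) : IsOfType (bToO4 Γ₀).range matD4 := by
  refine isOfType_of_perm ![![1, 3, 3, 3], ![3, 1, 2, 2], ![3, 2, 1, 2], ![3, 2, 2, 1]]
    (fun i j => rfl) (by decide) e
    ![1, [1, 2, 3].formPerm, [0, 1, 3].formPerm, [0, 2, 1].formPerm]
    (fun i => Equiv.Perm.mem_alternatingGroup.mpr (by revert i; decide +kernel))
    (by decide +kernel) (fun i j _ hij => absurd hij (by revert i j; decide))
    -- All leaves hang on the vertex `0`. The Gram matrix sends the weights `5, 3, 3, 3` to `1/2` in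
    -- each coordinate.
    ![0, 0, 0, 0] (by decide) (by decide) ![5, 3, 3, 3] ?_
    [(1, 0), (2, 0), (3, 0), (2, 4), (3, 4), (3, 5), (3, 7), (0, 10)]
    (by decide +kernel) ?_
  · simp [Fin.forall_fin_succ, Fin.sum_univ_four]
    norm_num
  · rw [nat_card_alternatingGroup]
    simp [reflectList, Nat.factorial]

theorem isOfType_F4 {Γ₀ : Subgroup (Matrix.specialOrthogonalGroup (Fin 3) ℝ)}
    (e : Equiv.Perm (Fin 4) ≃* Γ₀) : IsOfType (bToO4 Γ₀).range CoxeterMatrix.F₄ := by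
  refine isOfType_of_perm ![![1, 3, 2, 2], ![3, 1, 4, 2], ![2, 4, 1, 3], ![2, 2, 3, 1]]
    (fun i j => rfl) (by decide) (Subgroup.topEquiv.trans e)
    ![[1, 2, 3].formPerm, 1, [0, 1, 2, 3].formPerm, [2, 3].formPerm]
    (fun i => Subgroup.mem_top _)
    (by decide +kernel) (fun i j _ hij => absurd hij (by revert i j; decide))
    -- The graph is a path. The Gram matrix sends the weights to `1` at the ends and `14.5 - 10√2`
    -- in the middle, whence the bound on `√2`. The `20` steps below complete the four roots to the
    -- `24` elements.
    ![0, 0, 1, 2] (by decide) (by decide) ![11, 20, 20, 11] ?_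
    [(1, 0), (2, 1), (1, 2), (3, 2), (2, 4), (3, 5), (0, 6), (3, 6), (1, 8), (3, 8), (3, 10),
      (2, 11), (3, 12), (2, 14), (2, 16), (1, 17), (1, 18), (2, 19), (0, 20), (3, 21)]
    (by decide +kernel) ?_
  · have h2 : √2 < 1.45 := by rw [Real.sqrt_lt'] <;> norm_num
    simp [Fin.forall_fin_succ, Fin.sum_univ_four]
    refine ⟨?_, ?_, ?_, ?_⟩ <;> linarith
  · simp [reflectList, Fintype.card_perm, Nat.factorial]

theorem isOfType_H4 {Γ₀ : Subgroup (Matrix.specialOrthogonalGroup (Fin 3) ℝ)}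
    (e : alternatingGroup (Fin 5) ≃* Γ₀) : IsOfType (bToO4 Γ₀).range CoxeterMatrix.H₄ := by
  have hg : ([0, 4, 1, 2, 3].formPerm)⁻¹ ∈ alternatingGroup (Fin 5) :=
    Equiv.Perm.mem_alternatingGroup.mpr (by decide +kernel)
  obtain ⟨e, he⟩ : ∃ e : alternatingGroup (Fin 5) ≃* Γ₀, ∀ c : S3, toSO3 c = (e ⟨_, hg⟩ : Γ₀) →
      |(c : ℍ[ℝ]).re| = Real.cos (Real.pi / (5 : ℕ)) := by
    obtain ⟨a, ha⟩ := toSO3_surjective (e ⟨_, hg⟩ : Γ₀)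
    have h5 : orderOf (toSO3 a) = 5 := by
      rw [ha, Subgroup.orderOf_coe, MulEquiv.orderOf_eq, ← Subgroup.orderOf_coe,
        orderOf_eq_iff (by norm_num)]
      dsimp only
      decide +kernel
    rcases abs_re_eq_or_of_orderOf_eq_five h5 with h | h
    · exact ⟨e, fun c hc => by rw [← h]; exact abs_re_eq_of_toSO3_eq (hc.trans ha.symm)⟩
    -- Here the rotation has the wrong angle but its square has the right one. Conjugation by this
    -- odd `4`-cycle, an outer automorphism of `Alt_5`, sends the `5`-cycle to its square; composing
    -- it with `e` corrects the angle.
    · refine ⟨(MulAut.conjNormal ([3, 2, 4, 1].formPerm : Equiv.Perm (Fin 5))).trans e,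
        fun c hc => ?_⟩
      rw [← h]
      refine abs_re_eq_of_toSO3_eq (hc.trans ?_)
      have h2 : MulAut.conjNormal ([3, 2, 4, 1].formPerm : Equiv.Perm (Fin 5))
          (⟨_, hg⟩ : alternatingGroup (Fin 5)) = ⟨_, hg⟩ ^ 2 := by
        apply Subtype.ext
        rw [MulAut.conjNormal_apply]
        change _ = (_ : Equiv.Perm (Fin 5)) ^ 2
        dsimp only
        decide +kernel
      rw [MulEquiv.trans_apply, h2, map_pow, map_pow, ha]
      rfl
  refine isOfType_of_perm ![![1, 3, 2, 2], ![3, 1, 3, 2], ![2, 3, 1, 5], ![2, 2, 5, 1]]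
    (fun i j => rfl) (by decide) e
    ![[1, 2].formPerm * [3, 4].formPerm, [2, 3, 4].formPerm, 1, [0, 4, 1, 2, 3].formPerm]
    (fun i => Equiv.Perm.mem_alternatingGroup.mpr (by revert i; decide +kernel))
    (by decide +kernel) ?_
    -- Weights on the path with positive image under the Gram matrix; the margin at the last vertex,
    -- `162 - 200 cos(π/5)`, is about `0.2`, whence the sharp bound on `√5`.
    ![0, 0, 1, 2] (by decide) (by decide) ![69, 136, 200, 162] ?_
    [(1, 0), (2, 1), (3, 2), (2, 3), (2, 4), (3, 5), (2, 6), (1, 7), (3, 8), (2, 9), (1, 10),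
      (0, 11), (2, 12), (1, 13), (3, 13), (0, 14), (1, 16), (3, 16), (0, 17), (3, 17), (0, 20),
      (3, 20), (3, 22), (2, 23), (3, 24), (2, 25), (2, 26), (2, 28), (3, 29), (1, 30), (1, 31),
      (3, 31), (2, 32), (3, 34), (2, 35), (1, 36), (2, 37), (1, 38), (0, 39), (1, 40), (3, 40),
      (0, 41), (0, 43), (3, 43), (3, 46), (2, 47), (2, 48), (3, 49), (1, 50), (3, 50), (3, 52),
      (2, 54), (3, 55), (2, 56), (1, 57), (0, 58)]
    (by decide +kernel) ?_
  · intro i j hij h4 c hc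
    have h23 : i = 2 ∧ j = 3 := by clear hc; revert i j; decide
    obtain ⟨rfl, rfl⟩ := h23
    refine he c (hc.trans ?_)
    congr 2
  · have h5 : √5 < 2.2361 := by rw [Real.sqrt_lt'] <;> norm_num
    simp [Fin.forall_fin_succ, Fin.sum_univ_four]
    refine ⟨?_, ?_, ?_, ?_⟩ <;> linarith
  · rw [nat_card_alternatingGroup]
    simp [reflectList, Nat.factorial]

/-! ### Cyclic and dihedral groups -/

theorem inner_mul_left_S3 (s a b : S3) :
    inner ℝ ((s * a : S3) : ℍ[ℝ]) ((s * b : S3) : ℍ[ℝ]) = inner ℝ (a : ℍ[ℝ]) (b : ℍ[ℝ]) := by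
  have h := (biMul s 1).inner_map_map a b
  simpa [biMul_apply] using h

/-- `y rⁿ⁺² = (y rⁿ⁺¹) (y rⁿ)⁻¹ (y rⁿ⁺¹)`. -/
theorem mul_pow_mem_of_closed {G : Type*} [Group G] {S : Set G}
    (hS : ∀ x ∈ S, ∀ y ∈ S, x * y⁻¹ * x ∈ S) {y r : G} (h0 : y ∈ S) (h1 : y * r ∈ S) (n : ℕ) :
    y * r ^ n ∈ S := by
  induction n using Nat.twoStepInduction with
  | zero => simpa using h0
  | one => simpa using h1
  | more n ih0 ih1 =>
    convert hS _ ih1 _ ih0 using 1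
    group

/-- The simple roots of type `I_2(m)` attached to a rotation of order `m`. -/
theorem exists_roots_I2 (R : Matrix.specialOrthogonalGroup (Fin 3) ℝ) {m : ℕ} (hm : 0 < m)
    (h : orderOf R = m) :
    ∃ u : Fin (rankI2 m) → S3, (∀ i, toSO3 (u i) ∈ Subgroup.zpowers R) ∧
      (∀ i j, matI2 m i j ≠ 0) ∧
      (∀ i j, (toSO3 (u i) * (toSO3 (u j))⁻¹) ^ matI2 m i j = 1) ∧
      (∀ i j, inner ℝ (u i : ℍ[ℝ]) (u j : ℍ[ℝ]) = -Real.cos (Real.pi / matI2 m i j)) ∧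
      (∀ i, 0 < inner ℝ (∑ j, (u j : ℍ[ℝ])) (u i : ℍ[ℝ])) ∧
      ∀ (S : Set (Matrix.specialOrthogonalGroup (Fin 3) ℝ)) (y),
        (∀ x ∈ S, ∀ y ∈ S, x * y⁻¹ * x ∈ S) → (∀ i, y * toSO3 (u i) ∈ S) →
        ∀ x ∈ Subgroup.zpowers R, y * x ∈ S := by
  obtain _ | _ | n := m
  · omega
  · have hM (i j) : matI2 1 i j = 1 := by
      rw [Subsingleton.elim (α := Fin 1) i j]
      exact (matI2 1).diagonal j
    rw [zero_add, orderOf_eq_one_iff] at h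
    subst h
    refine ⟨fun _ => 1, fun _ => by simp, fun i j => by simp [hM], fun i j => by simp,
      fun i j => ?_, fun i => ?_, fun S y _ hS x hx => ?_⟩
    · rw [inner_self_S3]; simp [hM]
    · have hsum : ∑ _j : Fin (rankI2 (0 + 1)), ((1 : S3) : ℍ[ℝ]) = (1 : S3) :=
        Fin.sum_univ_one _
      rw [hsum, inner_self_S3]
      exact one_pos
    · rw [Subgroup.zpowers_one_eq_bot, Subgroup.mem_bot] at hx
      subst hx
      simpa using hS (0 : Fin 1)
  · obtain ⟨a, rfl⟩ := toSO3_surjective R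
    -- The simple roots are `1` and a lift `b`, of nonpositive real part, of a generator of angle
    -- `±2π/m`.
    obtain ⟨j, hj, hre⟩ := exists_pow_abs_re_eq a (by omega) h
    obtain ⟨b, hb, hneg⟩ := exists_lift_inner_nonpos (toSO3 a ^ j) 1
    rw [← map_pow] at hb
    have hb1 : inner ℝ ((1 : S3) : ℍ[ℝ]) (b : ℍ[ℝ]) = -Real.cos (Real.pi / (n + 2 : ℕ)) := by
      have h1 : inner ℝ ((1 : S3) : ℍ[ℝ]) (b : ℍ[ℝ]) = (b : ℍ[ℝ]).re := by
        rw [real_inner_comm, inner_S3, inv_one, mul_one]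
      rw [← hre, ← abs_re_eq_of_toSO3_eq hb, ← h1, abs_of_nonpos hneg, neg_neg]
    have hbpow : toSO3 b ^ (n + 2) = 1 := by
      rw [hb, map_pow, ← pow_mul, mul_comm, pow_mul, ← h, pow_orderOf_eq_one, one_pow]
    have hcos : Real.cos (Real.pi / (n + 2 : ℕ)) < 1 := by
      have hn : (2 : ℝ) ≤ (n + 2 : ℕ) := by push_cast; linarith [Nat.cast_nonneg (α := ℝ) n]
      have hpi := Real.pi_pos
      rw [← Real.cos_zero]
      apply Real.cos_lt_cos_of_nonneg_of_le_pi le_rfl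
      · exact div_le_self hpi.le (by linarith)
      · positivity
    have hM (i j : Fin 2) : matI2 (n + 2) i j = if i = j then 1 else n + 2 := rfl
    have hb1' := real_inner_comm ((1 : S3) : ℍ[ℝ]) (b : ℍ[ℝ])
    rw [hb1] at hb1'
    refine ⟨(![1, b] : Fin 2 → S3), ?_, ?_, ?_, ?_, ?_, ?_⟩
    · refine Fin.forall_fin_two.mpr ⟨by simp, ?_⟩
      change toSO3 b ∈ _
      rw [hb, map_pow]
      exact Subgroup.npow_mem_zpowers _ _
    · intro i j
      exact (hM i j).trans_ne (by split_ifs <;> omega)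
    · refine Fin.forall_fin_two.mpr ⟨Fin.forall_fin_two.mpr ⟨?_, ?_⟩,
        Fin.forall_fin_two.mpr ⟨?_, ?_⟩⟩ <;> rw [hM] <;> simp [hbpow]
    · refine Fin.forall_fin_two.mpr ⟨Fin.forall_fin_two.mpr ⟨?_, ?_⟩,
        Fin.forall_fin_two.mpr ⟨?_, ?_⟩⟩ <;> rw [hM]
      · exact (inner_self_S3 1).trans (by simp)
      · exact hb1
      · exact hb1'
      · exact (inner_self_S3 b).trans (by simp)
    · intro i
      have hsum : ∑ j, (((![1, b] : Fin 2 → S3) j : S3) : ℍ[ℝ]) = ((1 : S3) : ℍ[ℝ]) + b :=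
        Fin.sum_univ_two _
      refine lt_of_lt_of_eq ?_ (congrArg (fun z : ℍ[ℝ] => inner ℝ z _) hsum.symm)
      rw [inner_add_left]
      revert i
      refine Fin.forall_fin_two.mpr ⟨?_, ?_⟩
      · change 0 < inner ℝ ((1 : S3) : ℍ[ℝ]) ((1 : S3) : ℍ[ℝ])
          + inner ℝ (b : ℍ[ℝ]) ((1 : S3) : ℍ[ℝ])
        rw [inner_self_S3, hb1']; linarith
      · change 0 < inner ℝ ((1 : S3) : ℍ[ℝ]) (b : ℍ[ℝ]) + inner ℝ (b : ℍ[ℝ]) (b : ℍ[ℝ])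
        rw [inner_self_S3, hb1]; linarith
    -- The left factor `y` is there for the dihedral case, where it carries the rotations to the
    -- other coset. Coprimality of `j` and `m` makes every power of the given rotation a power of
    -- `toSO3 b`.
    · intro S y hS hy x hx
      have h0 : y ∈ S := by simpa using hy (0 : Fin 2)
      have h1 : y * toSO3 b ∈ S := hy (1 : Fin 2)
      obtain ⟨l, hl⟩ := exists_pow_eq_self_of_coprime (x := toSO3 a) (h.symm ▸ hj)
      have hfin : IsOfFinOrder (toSO3 a) := by rw [← orderOf_pos_iff, h]; omega
      obtain ⟨k, rfl⟩ := hfin.mem_powers_iff_mem_zpowers.mpr hx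
      have : toSO3 a ^ k = toSO3 b ^ (l * k) := by
        rw [pow_mul, hb, map_pow, hl]
      change y * toSO3 a ^ k ∈ S
      rw [this]
      exact mul_pow_mem_of_closed hS h0 h1 _

theorem isOfType_I2 {Γ₀ : Subgroup (Matrix.specialOrthogonalGroup (Fin 3) ℝ)} [Finite Γ₀]
    (hcyc : IsCyclic Γ₀) : IsOfType (bToO4 Γ₀).range (matI2 (Nat.card Γ₀)) := by
  obtain ⟨g, hg⟩ := hcyc.exists_generator
  have hord : orderOf (g : Matrix.specialOrthogonalGroup (Fin 3) ℝ) = Nat.card Γ₀ := by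
    rw [Subgroup.orderOf_coe, orderOf_eq_card_of_forall_mem_zpowers hg]
  obtain ⟨u, h1, h2, h3, h4, h5, h6⟩ := exists_roots_I2 _ Nat.card_pos hord
  refine isOfType_of_roots h2 u (fun i => ?_) h3 h4 h5 (fun S hS hmul x hx => ?_)
  · exact (Subgroup.zpowers_le.mpr g.2) (h1 i)
  · have h7 := h6 S 1 hmul (by simpa using hS) x (by
      obtain ⟨k, hk⟩ := hg ⟨x, hx⟩
      exact ⟨k, congrArg Subtype.val hk⟩)
    simpa using h7

/-- Let `s` lift an element outside the cyclic subgroup `C` of rotations of the dihedral group. The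
lifts of `C` and those of its other coset each carry a system of type `I_2(m)`, the second being the
image of the first under the isometry `z ↦ s z`. The two are orthogonal, because a quotient of
elements of different cosets has order `2`, hence lifts to real part `0`. -/
theorem isOfType_I2_prod_I2 {Γ₀ : Subgroup (Matrix.specialOrthogonalGroup (Fin 3) ℝ)} [Finite Γ₀]
    {m : ℕ} (e : Γ₀ ≃* DihedralGroup m) :
    IsOfType (bToO4 Γ₀).range (matProd (matI2 m) (matI2 m)) := by
  -- `DihedralGroup 0` is infinite.
  have hm : 0 < m := by
    rcases Nat.eq_zero_or_pos m with rfl | h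
    · have := Finite.of_equiv _ e.toEquiv
      exact absurd this (not_finite_iff_infinite.mpr inferInstance)
    · exact h
  let E : DihedralGroup m →* Matrix.specialOrthogonalGroup (Fin 3) ℝ :=
    Γ₀.subtype.comp e.symm.toMonoidHom
  have hE : Function.Injective E := Γ₀.subtype_injective.comp e.symm.injective
  have hEmem (x) : E x ∈ Γ₀ := (e.symm x).2
  have hord : orderOf (E (.r 1)) = m := by
    rw [orderOf_injective E hE, DihedralGroup.orderOf_r_one]
  have hz (x) (hx : x ∈ Subgroup.zpowers (E (.r 1))) : ∃ k, x = E (.r k) := by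
    obtain ⟨k, rfl⟩ := hx
    exact ⟨(k : ZMod m), by simp [← map_zpow]⟩
  have hr (k : ZMod m) : E (.r k) ∈ Subgroup.zpowers (E (.r 1)) := by
    obtain ⟨k, rfl⟩ := ZMod.intCast_surjective k
    exact ⟨k, by simp [← map_zpow]⟩
  obtain ⟨s, hs⟩ := toSO3_surjective (E (.sr 0))
  obtain ⟨u, h1, h2, h3, h4, h5, h6⟩ := exists_roots_I2 _ hm hord
  have hcross (i j) : orderOf (toSO3 (u i) * (toSO3 (s * u j))⁻¹) = 2 := by
    obtain ⟨k, hk⟩ := hz _ (h1 i)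
    obtain ⟨l, hl⟩ := hz _ (h1 j)
    rw [map_mul, hk, hl, hs, ← map_mul, ← map_inv, ← map_mul, orderOf_injective E hE]
    simp
  have hcross' (i j) : inner ℝ (u i : ℍ[ℝ]) ((s * u j : S3) : ℍ[ℝ]) = 0 := by
    have h := abs_re_eq_of_orderOf_le_four le_rfl (by norm_num)
      (a := u i * (s * u j)⁻¹) (by rw [map_mul toSO3 (u i), map_inv]; exact hcross i j)
    rw [← inner_S3] at h
    simpa using h
  have hll (i j) : matProd (matI2 m) (matI2 m) (.inl i) (.inl j) = matI2 m i j := rfl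
  have hlr (i j) : matProd (matI2 m) (matI2 m) (.inl i) (.inr j) = 2 := rfl
  have hrl (i j) : matProd (matI2 m) (matI2 m) (.inr i) (.inl j) = 2 := rfl
  have hrr (i j) : matProd (matI2 m) (matI2 m) (.inr i) (.inr j) = matI2 m i j := rfl
  refine isOfType_of_roots (M := matProd (matI2 m) (matI2 m)) ?_
    (Sum.elim u fun i => s * u i) ?_ ?_ ?_
    (ρ := ∑ j, (u j : ℍ[ℝ]) + ∑ j, ((s * u j : S3) : ℍ[ℝ])) ?_ ?_
  · rintro (i | i) (j | j)
    · rw [hll]; exact h2 i j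
    · rw [hlr]; norm_num
    · rw [hrl]; norm_num
    · rw [hrr]; exact h2 i j
  · have h (i) : toSO3 (u i) ∈ Γ₀ := Subgroup.zpowers_le.mpr (hEmem _) (h1 i)
    rintro (i | i)
    · exact h i
    · change toSO3 (s * u i) ∈ Γ₀
      rw [map_mul, hs]
      exact mul_mem (hEmem _) (h i)
  · rintro (i | i) (j | j)
    · rw [hll]; exact h3 i j
    · rw [hlr, ← hcross i j]; exact pow_orderOf_eq_one _
    · rw [hrl, ← inv_inj, ← inv_pow, mul_inv_rev, inv_inv, inv_one, ← hcross j i]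
      exact pow_orderOf_eq_one _
    · rw [hrr]
      simp only [Sum.elim_inr, map_mul, mul_inv_rev]
      have : toSO3 s * toSO3 (u i) * ((toSO3 (u j))⁻¹ * (toSO3 s)⁻¹)
          = toSO3 s * (toSO3 (u i) * (toSO3 (u j))⁻¹) * (toSO3 s)⁻¹ := by group
      rw [this, conj_pow, h3, mul_one, mul_inv_cancel]
  · rintro (i | i) (j | j)
    · rw [hll]; exact h4 i j
    · rw [hlr]; simpa using hcross' i j
    · rw [hrl, real_inner_comm]; simpa using hcross' j i
    · rw [hrr, ← h4 i j]; exact inner_mul_left_S3 s _ _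
  · rintro (i | i)
    · rw [Sum.elim_inl, inner_add_left, sum_inner (f := fun j => ((s * u j : S3) : ℍ[ℝ]))]
      have hsu (j) : inner ℝ ((s * u j : S3) : ℍ[ℝ]) (u i : ℍ[ℝ]) = 0 := by
        rw [real_inner_comm]; exact hcross' i j
      simpa only [hsu, Finset.sum_const_zero, add_zero] using h5 i
    · rw [Sum.elim_inr, inner_add_left, sum_inner, sum_inner]
      have h7 := h5 i
      rw [sum_inner] at h7
      simpa only [hcross', inner_mul_left_S3, Finset.sum_const_zero, zero_add] using h7
  · intro S hS hmul x hx
    obtain ⟨y, hy⟩ : ∃ y, E y = x := ⟨e ⟨x, hx⟩, by simp [E]⟩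
    subst hy
    rcases y with k | k
    · have h7 := h6 S 1 hmul (fun i => by simpa using hS (.inl i)) _ (hr k)
      simpa using h7
    · have h7 := h6 S (toSO3 s) hmul (fun i => by simpa using hS (.inr i)) _ (hr k)
      rw [hs, ← map_mul] at h7
      simpa using h7

end SerreCoxeter

end

theorem mainTheorem2
    (Γ₀ : Subgroup (Matrix.specialOrthogonalGroup (Fin 3) ℝ)) [Finite Γ₀] :
    Function.Injective (SerreCoxeter.bToO4 Γ₀) ∧
    SerreCoxeter.IsFiniteReflectionGroup (SerreCoxeter.bToO4 Γ₀).range ∧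
    (∀ m : ℕ, IsCyclic Γ₀ → Nat.card Γ₀ = m →
      SerreCoxeter.IsOfType (SerreCoxeter.bToO4 Γ₀).range (SerreCoxeter.matI2 m)) ∧
    (∀ m : ℕ, Nonempty (Γ₀ ≃* DihedralGroup m) →
      SerreCoxeter.IsOfType (SerreCoxeter.bToO4 Γ₀).range
        (SerreCoxeter.matProd (SerreCoxeter.matI2 m) (SerreCoxeter.matI2 m))) ∧
    (Nonempty (Γ₀ ≃* alternatingGroup (Fin 4)) →
      SerreCoxeter.IsOfType (SerreCoxeter.bToO4 Γ₀).range SerreCoxeter.matD4) ∧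
    (Nonempty (Γ₀ ≃* Equiv.Perm (Fin 4)) →
      SerreCoxeter.IsOfType (SerreCoxeter.bToO4 Γ₀).range CoxeterMatrix.F₄) ∧
    (Nonempty (Γ₀ ≃* alternatingGroup (Fin 5)) →
      SerreCoxeter.IsOfType (SerreCoxeter.bToO4 Γ₀).range CoxeterMatrix.H₄) := by
  refine ⟨SerreCoxeter.bToO4_injective Γ₀, SerreCoxeter.isFiniteReflectionGroup_range_bToO4 Γ₀,
    ?_, ?_, ?_, ?_, ?_⟩
  · rintro m hcyc rfl
    exact SerreCoxeter.isOfType_I2 hcyc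
  · rintro m ⟨e⟩
    exact SerreCoxeter.isOfType_I2_prod_I2 e
  · rintro ⟨e⟩
    exact SerreCoxeter.isOfType_D4 e.symm
  · rintro ⟨e⟩
    exact SerreCoxeter.isOfType_F4 e.symm
  · rintro ⟨e⟩
    exact SerreCoxeter.isOfType_H4 e.symm
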